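/- Let $k\in\mathbb{N}$. A $k$-graph is a countable small category $\Lambda$ with a functor $d:\Lambda\to\mathbb{N}^k$ (the degree) such that whenever $d(\lambda)=m+n$ there are unique $\mu,\nu\in\Lambda$ with $d(\mu)=m$, $d(\nu)=n$ and $\lambda=\mu\nu$. Objects are called vertices, morphisms are called paths, $r(\lambda)$ and $s(\lambda)$ denote the codomain and the domain of $\lambda$; $v\Lambda^n$ is the set of paths of degree $n$ with range $v$, and $v\Lambda w$ is the set of paths with range $v$ and source $w$. $\Lambda$ is row-finite if every $v\Lambda^n$ is finite, and locally convex if for all $i\ne j$ and all $\lambda,\mu$ with $d(\lambda)=e_i$, $d(\mu)=e_j$, $r(\lambda)=r(\mu)$, the sets $s(\lambda)\Lambda^{e_j}$ and $s(\mu)\Lambda^{e_i}$ are non-empty. For $m\in(\mathbb{N}\cup\{\infty\})^k$ let $\Omega_{k,m}$ be the $k$-graph with objects $\{p\in\mathbb{N}^k:p\le m\}$ and morphisms the pairs $(p,q)$ with $p\le q\le m$, where $(p,q)$ has range $p$, source $q$ and degree $q-p$. A boundary path of $\Lambda$ of degree $d(x)=m$ is a degree-preserving functor $x:\Omega_{k,m}\to\Lambda$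 such that $x(p)\Lambda^{e_i}=\emptyset$ whenever $p\le m$ and $p_i=m_i$; an infinite path is a degree-preserving functor $\Omega_{k,(\infty,\dots,\infty)}\to\Lambda$. We say that $\Lambda$ is cofinal if for every boundary path $x$ and every vertex $v$ there is $n\in\mathbb{N}^k$ with $n\le d(x)$ and $v\Lambda x(n)\neq\emptyset$. Let $\Lambda$ be a row-finite locally convex $k$-graph. Let $\widetilde\Lambda$ be the $k$-graph without sources obtained from $\Lambda$ by removing sources: its vertices are the classes $[x;m]$ of pairs of a boundary path $x$ and $m\in\mathbb{N}^k$, where $(x;m)\sim(y;n)$ iff $x(m\wedge d(x))=y(n\wedge d(y))$ and $m-m\wedge d(x)=n-n\wedge d(y)$; its paths are the classes $[x;(m,n)]$ with $m\le n$ in $\mathbb{N}^k$, where $(x;(m,n))\approx(y;(p,q))$ iff $x(m\wedge d(x),n\wedge d(x))=y(p\wedge d(y),q\wedge d(y))$, $m-m\wedge d(x)=p-p\wedge d(y)$ and $n-m=q-p$; the range, source and degree of $[x;(m,n)]$ are $[x;m]$, $[x;n]$ and $n-m$, the identity at $[x;m]$ is $[x;(m,m)]$, and $$[x;(m,n)]\,[y;(p,q)]=\big[x(0,n\wedge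 d(x))\,\sigma^{p\wedge d(y)}(y);(m,n+q-p)\big]\quad\text{if }[x;n]=[y;p],$$ where $\sigma^a(y)(p,q)=y(p+a,q+a)$ is the shifted boundary path and $\lambda z$ denotes the concatenation of a path $\lambda$ with a boundary path $z$ such that $z(0)=s(\lambda)$. Then $\Lambda$ is cofinal if and only if $\widetilde\Lambda$ is cofinal. Equivalently, in terms of the usual cofinality condition for $k$-graphs without sources: $\Lambda$ is cofinal if and only if for every infinite path $z$ of $\widetilde\Lambda$ and every vertex $v$ of $\widetilde\Lambda$ there is $n\in\mathbb{N}^k$ with $v\widetilde\Lambda z(n)\neq\emptyset$. -/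

import Mathlib

universe u v w

/-- A `k`-graph: a countable small category (with set of objects `Vert`, set of morphisms `Path`,
codomain map `r`, domain map `s`, and `comp f g` the composite `f ∘ g`, defined when the domain
of `f` is the codomain of `g`), together with a degree functor `d` to `ℕ^k` that has the
factorisation property. -/
structure KGraph (k : ℕ) where
  /-- the objects -/
  Vert : Type u
  /-- the morphisms -/
  Path : Type u
  /-- the range (codomain) of a path -/
  r : Path → Vert
  /-- the source (domain) of a path -/
  s : Path → Vert
  /-- the identity morphisms -/
  id : Vert → Path
  /-- composition of composable paths -/
  comp : ∀ f g : Path, s f = r g → Path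
  r_id : ∀ a, r (id a) = a
  s_id : ∀ a, s (id a) = a
  r_comp : ∀ f g h, r (comp f g h) = r f
  s_comp : ∀ f g h, s (comp f g h) = s g
  id_comp : ∀ f, comp (id (r f)) f (s_id _) = f
  comp_id : ∀ f, comp f (id (s f)) (r_id _).symm = f
  assoc : ∀ f g h (hfg : s f = r g) (hgh : s g = r h),
    comp (comp f g hfg) h ((s_comp f g hfg).trans hgh) =
      comp f (comp g h hgh) (hfg.trans (r_comp g h hgh).symm)
  countable_path : Countable Path
  /-- the degree functor -/
  d : Path → (Fin k → ℕ)
  d_id : ∀ a, d (id a) = 0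
  d_comp : ∀ f g h, d (comp f g h) = d f + d g
  factorisation : ∀ (f : Path) (m n : Fin k → ℕ), d f = m + n →
    ∃! p : Path × Path, d p.1 = m ∧ d p.2 = n ∧ ∃ h : s p.1 = r p.2, comp p.1 p.2 h = f

namespace KGraph

variable {k : ℕ}

/-- `Λ` is row-finite: `vΛⁿ` is finite for all vertices `v` and all `n ∈ ℕ^k`. -/
def RowFinite (Λ : KGraph.{u} k) : Prop :=
  ∀ (a : Λ.Vert) (n : Fin k → ℕ), {f : Λ.Path | Λ.r f = a ∧ Λ.d f = n}.Finite

/-- `vΛⁿ` is non-empty. -/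
def Receives (Λ : KGraph.{u} k) (a : Λ.Vert) (n : Fin k → ℕ) : Prop :=
  ∃ f : Λ.Path, Λ.r f = a ∧ Λ.d f = n

/-- `Λ` is locally convex: for `i ≠ j`, `f ∈ Λ^{e_i}` and `g ∈ Λ^{e_j}` with `r f = r g`,
the sets `s(f)Λ^{e_j}` and `s(g)Λ^{e_i}` are non-empty. -/
def LocallyConvex (Λ : KGraph.{u} k) : Prop :=
  ∀ (i j : Fin k), i ≠ j → ∀ f g : Λ.Path, Λ.d f = Pi.single i 1 → Λ.d g = Pi.single j 1 →
    Λ.r f = Λ.r g →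
      Λ.Receives (Λ.s f) (Pi.single j 1) ∧ Λ.Receives (Λ.s g) (Pi.single i 1)

/-- A degree-preserving functor between `k`-graphs. -/
structure Hom (Λ : KGraph.{v} k) (Γ : KGraph.{w} k) where
  obj : Λ.Vert → Γ.Vert
  map : Λ.Path → Γ.Path
  r_map : ∀ f, Γ.r (map f) = obj (Λ.r f)
  s_map : ∀ f, Γ.s (map f) = obj (Λ.s f)
  map_id : ∀ a, map (Λ.id a) = Γ.id (obj a)
  map_comp : ∀ f g h, map (Λ.comp f g h) =
    Γ.comp (map f) (map g) (by rw [s_map, r_map, h])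
  d_map : ∀ f, Γ.d (map f) = Λ.d f

/-- `n ≤ m` for `n ∈ ℕ^k` and `m ∈ (ℕ ∪ {∞})^k`. -/
def Le (n : Fin k → ℕ) (m : Fin k → ℕ∞) : Prop := ∀ i, (n i : ℕ∞) ≤ m i

theorem Le.mono {p q : Fin k → ℕ} {m : Fin k → ℕ∞} (hpq : p ≤ q) (hq : Le q m) : Le p m :=
  fun i => le_trans (by exact_mod_cast hpq i) (hq i)

theorem Le.zero (m : Fin k → ℕ∞) : Le (0 : Fin k → ℕ) m := fun i => by simp

/-- The `k`-graph `Ω_{k,m}`: its objects are the `p ∈ ℕ^k` with `p ≤ m`, its morphisms the pairs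
`(p, q)` with `p ≤ q ≤ m`; the pair `(p, q)` has codomain `p`, domain `q` and degree `q - p`. -/
def Omega (k : ℕ) (m : Fin k → ℕ∞) : KGraph.{0} k where
  Vert := {p : Fin k → ℕ // Le p m}
  Path := {f : (Fin k → ℕ) × (Fin k → ℕ) // f.1 ≤ f.2 ∧ Le f.2 m}
  r f := ⟨f.1.1, Le.mono f.2.1 f.2.2⟩
  s f := ⟨f.1.2, f.2.2⟩
  id p := ⟨(p.1, p.1), le_refl _, p.2⟩
  comp f g h := ⟨(f.1.1, g.1.2),
    f.2.1.trans ((Subtype.ext_iff.1 h).le.trans g.2.1), g.2.2⟩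
  r_id _ := rfl
  s_id _ := rfl
  r_comp _ _ _ := rfl
  s_comp _ _ _ := rfl
  id_comp _ := rfl
  comp_id _ := rfl
  assoc _ _ _ _ _ := rfl
  countable_path := inferInstance
  d f := f.1.2 - f.1.1
  d_id _ := by simp
  d_comp f g h := by
    have h' : f.1.2 = g.1.1 := Subtype.ext_iff.1 h
    funext i
    have h1 := f.2.1 i
    have h2 := g.2.1 i
    have h3 := congrFun h' i
    change g.1.2 i - f.1.1 i = (f.1.2 i - f.1.1 i) + (g.1.2 i - g.1.1 i)
    change f.1.1 i ≤ f.1.2 i at h1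
    change g.1.1 i ≤ g.1.2 i at h2
    omega
  factorisation := by
    rintro ⟨⟨p, q⟩, hpq, hq⟩ a b hd
    replace hd : q - p = a + b := hd
    replace hpq : p ≤ q := hpq
    have hq' : q = p + a + b := by
      rw [add_assoc, ← hd, add_tsub_cancel_of_le hpq]
    subst hq'
    have h1 : p ≤ p + a := le_self_add
    have h2 : p + a ≤ p + a + b := le_self_add
    refine ⟨(⟨(p, p + a), h1, Le.mono h2 hq⟩, ⟨(p + a, p + a + b), h2, hq⟩),
      ⟨by simp, by simp, rfl, rfl⟩, ?_⟩
    rintro ⟨⟨⟨p1, q1⟩, h11, h12⟩, ⟨⟨p2, q2⟩, h21, h22⟩⟩ ⟨e1, e2, e3, e4⟩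
    replace e1 : q1 - p1 = a := e1
    replace e2 : q2 - p2 = b := e2
    have e3' : q1 = p2 := Subtype.ext_iff.1 e3
    have e4' : (p1, q2) = (p, p + a + b) := Subtype.ext_iff.1 e4
    obtain ⟨rfl, rfl⟩ := Prod.mk.inj e4'
    subst e3'
    have : q1 = p1 + a := by rw [← e1, add_tsub_cancel_of_le h11]
    subst this
    rfl

/-- A boundary path of `Λ`: a degree `deg ∈ (ℕ ∪ {∞})^k` and a degree-preserving functor
`x : Ω_{k,deg} → Λ` such that `x(p)Λ^{e_i} = ∅` whenever `p ≤ deg` and `p_i = deg_i`. -/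
structure BoundaryPath (Λ : KGraph.{u} k) where
  deg : Fin k → ℕ∞
  hom : Hom (Omega k deg) Λ
  boundary : ∀ (p : Fin k → ℕ) (hp : Le p deg) (i : Fin k), (p i : ℕ∞) = deg i →
    ¬ Λ.Receives (hom.obj ⟨p, hp⟩) (Pi.single i 1)

/-- An infinite path of `Λ`: a degree-preserving functor `Ω_{k,(∞,…,∞)} → Λ`. -/
abbrev InfinitePath (Λ : KGraph.{u} k) := Hom (Omega k (fun _ => ⊤)) Λ

/-- Cofinality: for each boundary path `x` and each vertex `v` there is `n ≤ d(x)` such that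
`vΛx(n)` is non-empty. -/
def IsCofinal (Λ : KGraph.{u} k) : Prop :=
  ∀ (x : Λ.BoundaryPath) (a : Λ.Vert), ∃ (n : Fin k → ℕ) (hn : Le n x.deg),
    ∃ f : Λ.Path, Λ.r f = a ∧ Λ.s f = x.hom.obj ⟨n, hn⟩

/-- The usual cofinality condition for `k`-graphs without sources: for each infinite path `x`
and each vertex `v` there is `n ∈ ℕ^k` such that `vΛx(n)` is non-empty. -/
def IsInfinitePathCofinal (Λ : KGraph.{u} k) : Prop :=
  ∀ (x : Λ.InfinitePath) (a : Λ.Vert), ∃ n : Fin k → ℕ,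
    ∃ f : Λ.Path, Λ.r f = a ∧ Λ.s f = x.obj ⟨n, fun _ => le_top⟩

/-! ### Factorisations and segments -/

section Segments

variable (Λ : KGraph.{u} k)

/-- `h` is the composite of `f` and `g`. -/
def IsComp (f g h : Λ.Path) : Prop := ∃ hs : Λ.s f = Λ.r g, Λ.comp f g hs = h

variable {Λ}

theorem IsComp.r_eq {f g h : Λ.Path} (H : Λ.IsComp f g h) : Λ.r h = Λ.r f := by
  obtain ⟨hs, rfl⟩ := H; exact Λ.r_comp ..

theorem IsComp.s_eq {f g h : Λ.Path} (H : Λ.IsComp f g h) : Λ.s h = Λ.s g := by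
  obtain ⟨hs, rfl⟩ := H; exact Λ.s_comp ..

theorem IsComp.d_eq {f g h : Λ.Path} (H : Λ.IsComp f g h) : Λ.d h = Λ.d f + Λ.d g := by
  obtain ⟨hs, rfl⟩ := H; exact Λ.d_comp ..

theorem IsComp.unique {f g h h' : Λ.Path} (H : Λ.IsComp f g h) (H' : Λ.IsComp f g h') :
    h = h' := by
  obtain ⟨hs, rfl⟩ := H; obtain ⟨hs', rfl⟩ := H'; rfl

theorem IsComp.assoc {a b ab c f : Λ.Path} (H : Λ.IsComp a b ab) (H' : Λ.IsComp ab c f) :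
    ∃ bc, Λ.IsComp b c bc ∧ Λ.IsComp a bc f := by
  obtain ⟨hs, rfl⟩ := H; obtain ⟨hs', rfl⟩ := H'
  have h2 : Λ.s b = Λ.r c := by rw [← hs', Λ.s_comp]
  exact ⟨_, ⟨h2, rfl⟩, ⟨hs.trans (Λ.r_comp ..).symm, (Λ.assoc a b c hs h2).symm⟩⟩

theorem IsComp.assoc' {b c bc a f : Λ.Path} (H : Λ.IsComp b c bc) (H' : Λ.IsComp a bc f) :
    ∃ ab, Λ.IsComp a b ab ∧ Λ.IsComp ab c f := by
  obtain ⟨hs, rfl⟩ := H; obtain ⟨hs', rfl⟩ := H'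
  have h2 : Λ.s a = Λ.r b := by rw [hs', Λ.r_comp]
  exact ⟨_, ⟨h2, rfl⟩, ⟨(Λ.s_comp ..).trans hs, (Λ.assoc a b c h2 hs)⟩⟩

theorem IsComp.cancel {a b a' b' f : Λ.Path} (H : Λ.IsComp a b f) (H' : Λ.IsComp a' b' f)
    (hd : Λ.d a = Λ.d a') : a = a' ∧ b = b' := by
  have h1 := H.d_eq
  have h2 := H'.d_eq
  have h3 : Λ.d b' = Λ.d b := by
    rw [h1, hd] at h2; exact (add_left_cancel h2).symm
  obtain ⟨p, -, hp⟩ := Λ.factorisation f _ _ h1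
  have e1 := hp (a, b) ⟨rfl, rfl, H⟩
  have e2 := hp (a', b') ⟨hd.symm, h3, H'⟩
  exact Prod.mk.inj (e1.trans e2.symm)

theorem exists_isComp (f : Λ.Path) (m n : Fin k → ℕ) (h : Λ.d f = m + n) :
    ∃ a b, Λ.d a = m ∧ Λ.d b = n ∧ Λ.IsComp a b f := by
  obtain ⟨p, ⟨h1, h2, h3⟩, -⟩ := Λ.factorisation f m n h
  exact ⟨p.1, p.2, h1, h2, h3⟩

theorem isComp_id_left (f : Λ.Path) : Λ.IsComp (Λ.id (Λ.r f)) f f := ⟨_, Λ.id_comp f⟩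

theorem isComp_id_right (f : Λ.Path) : Λ.IsComp f (Λ.id (Λ.s f)) f := ⟨_, Λ.comp_id f⟩

theorem eq_id_of_d_eq_zero {f : Λ.Path} (h : Λ.d f = 0) : f = Λ.id (Λ.r f) :=
  ((isComp_id_left f).cancel (isComp_id_right f) (by rw [h, Λ.d_id])).1.symm

variable (Λ) in
/-- `b` is the segment `f(p, q)` of `f`, that is `f = a b c` with `d a = p` and `d b = q - p`. -/
def IsSeg (f : Λ.Path) (p q : Fin k → ℕ) (b : Λ.Path) : Prop :=
  ∃ a c ab, Λ.IsComp a b ab ∧ Λ.IsComp ab c f ∧ Λ.d a = p ∧ p + Λ.d b = q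

theorem exists_isSeg (f : Λ.Path) (p q : Fin k → ℕ) (hpq : p ≤ q) (hq : q ≤ Λ.d f) :
    ∃ b, Λ.IsSeg f p q b := by
  obtain ⟨ab, c, h1, -, h3⟩ := exists_isComp f q (Λ.d f - q) (add_tsub_cancel_of_le hq).symm
  obtain ⟨a, b, h4, h5, h6⟩ := exists_isComp ab p (q - p) (by
    rw [h1, add_tsub_cancel_of_le hpq])
  exact ⟨b, a, c, ab, h6, h3, h4, by rw [h5, add_tsub_cancel_of_le hpq]⟩

theorem IsSeg.unique {f : Λ.Path} {p q : Fin k → ℕ} {b b' : Λ.Path} (H : Λ.IsSeg f p q b)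
    (H' : Λ.IsSeg f p q b') : b = b' := by
  obtain ⟨a, c, ab, h1, h2, h3, h4⟩ := H
  obtain ⟨a', c', ab', h1', h2', h3', h4'⟩ := H'
  have : ab = ab' := (h2.cancel h2' (by rw [h1.d_eq, h1'.d_eq, h3, h4, h3', h4'])).1
  subst this
  exact (h1.cancel h1' (by rw [h3, h3'])).2

theorem IsSeg.d_add {f : Λ.Path} {p q : Fin k → ℕ} {b : Λ.Path} (H : Λ.IsSeg f p q b) :
    p + Λ.d b = q := by
  obtain ⟨a, c, ab, h1, h2, h3, h4⟩ := H; exact h4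

theorem IsSeg.trans {f : Λ.Path} {p q t : Fin k → ℕ} {b b' : Λ.Path} (H : Λ.IsSeg f p q b)
    (H' : Λ.IsSeg f q t b') : ∃ g, Λ.IsComp b b' g ∧ Λ.IsSeg f p t g := by
  obtain ⟨a, c, ab, h1, h2, h3, h4⟩ := H
  obtain ⟨a', c', ab', h1', h2', h3', h4'⟩ := H'
  obtain ⟨m, hm1, hm2⟩ := h1'.assoc h2'
  obtain ⟨rfl, rfl⟩ := h2.cancel hm2 (by rw [h1.d_eq, h3, h4, h3'])
  obtain ⟨g, hg1, hg2⟩ := h1.assoc h1'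
  exact ⟨g, hg1, a, c', ab', hg2, h2', h3, by rw [hg1.d_eq, ← add_assoc, h4, h4']⟩

theorem IsSeg.of_left {f g h : Λ.Path} {p q : Fin k → ℕ} {b : Λ.Path} (H : Λ.IsSeg f p q b)
    (H' : Λ.IsComp f g h) : Λ.IsSeg h p q b := by
  obtain ⟨a, c, ab, h1, h2, h3, h4⟩ := H
  obtain ⟨c', -, h5⟩ := h2.assoc H'
  exact ⟨a, c', ab, h1, h5, h3, h4⟩

theorem IsSeg.of_right {f g h : Λ.Path} {p q : Fin k → ℕ} {b : Λ.Path} (H : Λ.IsSeg g p q b)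
    (H' : Λ.IsComp f g h) : Λ.IsSeg h (Λ.d f + p) (Λ.d f + q) b := by
  obtain ⟨a, c, ab, h1, h2, h3, h4⟩ := H
  obtain ⟨fab, h5, h6⟩ := h2.assoc' H'
  obtain ⟨fa, h7, h8⟩ := h1.assoc' h5
  exact ⟨fa, c, fab, h8, h6, by rw [h7.d_eq, h3], by rw [add_assoc, h4]⟩

theorem isSeg_self (f : Λ.Path) : Λ.IsSeg f 0 (Λ.d f) f :=
  ⟨_, _, f, isComp_id_left f, isComp_id_right f, Λ.d_id _, zero_add _⟩

variable (Λ) in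
/-- The segment `f(p, q)` of `f`. -/
noncomputable def seg (f : Λ.Path) (p q : Fin k → ℕ) (hpq : p ≤ q) (hq : q ≤ Λ.d f) : Λ.Path :=
  (exists_isSeg f p q hpq hq).choose

theorem seg_spec (f : Λ.Path) (p q : Fin k → ℕ) (hpq : p ≤ q) (hq : q ≤ Λ.d f) :
    Λ.IsSeg f p q (Λ.seg f p q hpq hq) :=
  (exists_isSeg f p q hpq hq).choose_spec

/-- In a locally convex `k`-graph, an edge of degree `e_i` into the range of a path whose degree
vanishes at `i` forces one into its source. -/
theorem LocallyConvex.receives (hΛ : Λ.LocallyConvex) {i : Fin k} :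
    ∀ (N : ℕ) (f : Λ.Path), ∑ j, Λ.d f j = N → Λ.d f i = 0 →
      Λ.Receives (Λ.r f) (Pi.single i 1) → Λ.Receives (Λ.s f) (Pi.single i 1) := by
  intro N
  induction N with
  | zero =>
    intro f hN _ h
    have h0 : Λ.d f = 0 := by
      funext j
      exact (Finset.sum_eq_zero_iff.1 hN) j (Finset.mem_univ j)
    rw [eq_id_of_d_eq_zero h0, Λ.r_id] at h
    rw [eq_id_of_d_eq_zero h0, Λ.s_id]
    exact h
  | succ N ih =>
    intro f hN hi h
    obtain ⟨j, hj⟩ : ∃ j, Λ.d f j ≠ 0 := by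
      by_contra! hc
      simp [hc] at hN
    have hij : i ≠ j := by rintro rfl; exact hj hi
    have hle : (Pi.single j 1 : Fin k → ℕ) ≤ Λ.d f := by
      intro l
      by_cases hl : l = j
      · subst hl; simp; omega
      · simp [hl]
    obtain ⟨a, b, ha, hb, hab⟩ := exists_isComp f (Pi.single j 1) (Λ.d f - Pi.single j 1)
      (add_tsub_cancel_of_le hle).symm
    obtain ⟨e, he1, he2⟩ := h
    have h1 := (hΛ i j hij e a he2 ha (by rw [he1, hab.r_eq])).2
    have hs : Λ.s a = Λ.r b := hab.1
    rw [hab.s_eq]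
    refine ih b ?_ ?_ (hs ▸ h1)
    · have h2 : ∑ l, Λ.d f l = ∑ l, (Pi.single j 1 : Fin k → ℕ) l + ∑ l, Λ.d b l := by
        rw [← Finset.sum_add_distrib]
        refine Finset.sum_congr rfl fun l _ => ?_
        rw [hab.d_eq, ha]; rfl
      have h3 : ∑ l, (Pi.single j 1 : Fin k → ℕ) l = 1 := by simp
      omega
    · rw [hb]; simp [hi]

end Segments

/-! ### Shifts of boundary paths, and concatenation of a path with a boundary path -/

namespace BoundaryPath

variable {Λ : KGraph.{u} k}

/-- The path `x(p, q)`. -/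
def seg (x : Λ.BoundaryPath) (p q : Fin k → ℕ) (hpq : p ≤ q) (hq : Le q x.deg) : Λ.Path :=
  x.hom.map ⟨(p, q), hpq, hq⟩

/-- The vertex `x(p)`. -/
def vert (x : Λ.BoundaryPath) (p : Fin k → ℕ) (hp : Le p x.deg) : Λ.Vert := x.hom.obj ⟨p, hp⟩

theorem r_seg (x : Λ.BoundaryPath) (p q : Fin k → ℕ) (hpq : p ≤ q) (hq : Le q x.deg) :
    Λ.r (x.seg p q hpq hq) = x.vert p (Le.mono hpq hq) := x.hom.r_map _

theorem s_seg (x : Λ.BoundaryPath) (p q : Fin k → ℕ) (hpq : p ≤ q) (hq : Le q x.deg) :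
    Λ.s (x.seg p q hpq hq) = x.vert q hq := x.hom.s_map _

theorem d_seg (x : Λ.BoundaryPath) (p q : Fin k → ℕ) (hpq : p ≤ q) (hq : Le q x.deg) :
    Λ.d (x.seg p q hpq hq) = q - p := x.hom.d_map _

theorem isComp_seg (x : Λ.BoundaryPath) (p q t : Fin k → ℕ) (hpq : p ≤ q) (hqt : q ≤ t)
    (ht : Le t x.deg) :
    Λ.IsComp (x.seg p q hpq (Le.mono hqt ht)) (x.seg q t hqt ht)
      (x.seg p t (hpq.trans hqt) ht) :=
  ⟨by rw [r_seg, s_seg], (x.hom.map_comp ⟨(p, q), hpq, Le.mono hqt ht⟩ ⟨(q, t), hqt, ht⟩ rfl).symm⟩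

theorem seg_congr (x : Λ.BoundaryPath) {p q p' q' : Fin k → ℕ} (hp : p = p') (hq : q = q')
    (h1 : p ≤ q) (h2 : Le q x.deg) (h1' : p' ≤ q') (h2' : Le q' x.deg) :
    x.seg p q h1 h2 = x.seg p' q' h1' h2' := by
  subst hp; subst hq; rfl

theorem vert_congr (x : Λ.BoundaryPath) {p p' : Fin k → ℕ} (hp : p = p') (h : Le p x.deg)
    (h' : Le p' x.deg) : x.vert p h = x.vert p' h' := by
  subst hp; rfl

/-- The shift `σⁿ(x)`, of degree `d(x) - n`, with `σⁿ(x)(p, q) = x(p + n, q + n)`. -/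
def shift (x : Λ.BoundaryPath) (n : Fin k → ℕ) (hn : Le n x.deg) : Λ.BoundaryPath :=
  have key : ∀ p : Fin k → ℕ, Le p (fun i => x.deg i - n i) → Le (p + n) x.deg := fun p hp i => by
    have h1 := hp i
    have h2 := hn i
    simp only [Pi.add_apply, Nat.cast_add]
    calc (p i : ℕ∞) + n i ≤ (x.deg i - n i) + n i := by gcongr
      _ = x.deg i := tsub_add_cancel_of_le h2
  { deg := fun i => x.deg i - n i
    hom :=
      { obj := fun p => x.vert (p.1 + n) (key _ p.2)
        map := fun f => x.seg (f.1.1 + n) (f.1.2 + n) (add_le_add_left f.2.1 n) (key _ f.2.2)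
        r_map := fun f => x.r_seg ..
        s_map := fun f => x.s_seg ..
        map_id := fun p => x.hom.map_id ⟨p.1 + n, key _ p.2⟩
        map_comp := fun f g h => by
          have h' : f.1.2 = g.1.1 := Subtype.ext_iff.1 h
          obtain ⟨⟨p, q⟩, h1, h2⟩ := f
          obtain ⟨⟨q', t⟩, h3, h4⟩ := g
          replace h' : q = q' := h'
          subst h'
          exact (x.isComp_seg (p + n) (q + n) (t + n) _ _ (key _ h4)).2.symm
        d_map := fun f => (x.d_seg ..).trans (by
          funext i
          exact Nat.add_sub_add_right _ _ _) }
    boundary := fun p hp i hi => x.boundary (p + n) (key p hp) i (by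
      simp only [Pi.add_apply, Nat.cast_add, hi]
      exact tsub_add_cancel_of_le (hn i)) }

theorem le_tail {x : Λ.BoundaryPath} {f : Λ.Path} {q : Fin k → ℕ}
    (hq : Le q (fun i => (Λ.d f i : ℕ∞) + x.deg i)) : Le (q - Λ.d f) x.deg := fun i => by
  have := hq i
  simp only [Pi.sub_apply, ENat.natCast_sub]
  exact tsub_le_iff_left.2 this

/-- The initial segment `f x(0, q - d(f))` of `f x`; its degree is `q ∨ d(f)`. -/
def concatInit (f : Λ.Path) (x : Λ.BoundaryPath) (h : Λ.s f = x.vert 0 (Le.zero _))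
    (q : Fin k → ℕ) (hq : Le q (fun i => (Λ.d f i : ℕ∞) + x.deg i)) : Λ.Path :=
  Λ.comp f (x.seg 0 (q - Λ.d f) zero_le (le_tail hq)) (h.trans (x.r_seg ..).symm)

theorem le_d_concatInit (f : Λ.Path) (x : Λ.BoundaryPath) (h : Λ.s f = x.vert 0 (Le.zero _))
    (q : Fin k → ℕ) (hq : Le q (fun i => (Λ.d f i : ℕ∞) + x.deg i)) :
    q ≤ Λ.d (concatInit f x h q hq) := by
  rw [concatInit, Λ.d_comp, d_seg]
  intro i
  simp only [Pi.add_apply, Pi.sub_apply, Pi.zero_apply]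
  omega

/-- The path `(f x)(p, q)`. -/
noncomputable def concatSeg (f : Λ.Path) (x : Λ.BoundaryPath) (h : Λ.s f = x.vert 0 (Le.zero _))
    (p q : Fin k → ℕ) (hpq : p ≤ q) (hq : Le q (fun i => (Λ.d f i : ℕ∞) + x.deg i)) : Λ.Path :=
  Λ.seg (concatInit f x h q hq) p q hpq (le_d_concatInit f x h q hq)

theorem concatSeg_spec (f : Λ.Path) (x : Λ.BoundaryPath) (h : Λ.s f = x.vert 0 (Le.zero _))
    (p q t : Fin k → ℕ) (hpq : p ≤ q) (hqt : q ≤ t)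
    (ht : Le t (fun i => (Λ.d f i : ℕ∞) + x.deg i)) :
    Λ.IsSeg (concatInit f x h t ht) p q (concatSeg f x h p q hpq (Le.mono hqt ht)) := by
  have h1 := seg_spec (concatInit f x h q (Le.mono hqt ht)) p q hpq
    (le_d_concatInit f x h q (Le.mono hqt ht))
  have h2 := x.isComp_seg 0 (q - Λ.d f) (t - Λ.d f) zero_le
    (tsub_le_tsub_right hqt _) (le_tail ht)
  have h3 : Λ.IsComp f (x.seg 0 (t - Λ.d f) zero_le (le_tail ht))
    (concatInit f x h t ht) := ⟨_, rfl⟩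
  obtain ⟨m, hm1, hm2⟩ := h2.assoc' h3
  have : m = concatInit f x h q (Le.mono hqt ht) := hm1.unique ⟨_, rfl⟩
  subst this
  exact h1.of_left hm2

theorem isComp_concatSeg (f : Λ.Path) (x : Λ.BoundaryPath) (h : Λ.s f = x.vert 0 (Le.zero _))
    (p q t : Fin k → ℕ) (hpq : p ≤ q) (hqt : q ≤ t)
    (ht : Le t (fun i => (Λ.d f i : ℕ∞) + x.deg i)) :
    Λ.IsComp (concatSeg f x h p q hpq (Le.mono hqt ht)) (concatSeg f x h q t hqt ht)
      (concatSeg f x h p t (hpq.trans hqt) ht) := by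
  obtain ⟨g, h1, h2⟩ := (concatSeg_spec f x h p q t hpq hqt ht).trans
    (concatSeg_spec f x h q t t hqt le_rfl ht)
  rwa [h2.unique (concatSeg_spec f x h p t t (hpq.trans hqt) le_rfl ht)] at h1

theorem d_concatSeg (f : Λ.Path) (x : Λ.BoundaryPath) (h : Λ.s f = x.vert 0 (Le.zero _))
    (p q : Fin k → ℕ) (hpq : p ≤ q) (hq : Le q (fun i => (Λ.d f i : ℕ∞) + x.deg i)) :
    p + Λ.d (concatSeg f x h p q hpq hq) = q :=
  (concatSeg_spec f x h p q q hpq le_rfl hq).d_add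

/-- `(f x)(p, q) = f(p, q)` for `p ≤ q ≤ d(f)`. -/
theorem concatSeg_left (f : Λ.Path) (x : Λ.BoundaryPath) (h : Λ.s f = x.vert 0 (Le.zero _))
    (p q : Fin k → ℕ) (hpq : p ≤ q) (hq : Le q (fun i => (Λ.d f i : ℕ∞) + x.deg i))
    {b : Λ.Path} (hb : Λ.IsSeg f p q b) : concatSeg f x h p q hpq hq = b :=
  (concatSeg_spec f x h p q q hpq le_rfl hq).unique (hb.of_left ⟨_, rfl⟩)

/-- `(f x)(d(f) + p, d(f) + q) = x(p, q)`. -/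
theorem concatSeg_right (f : Λ.Path) (x : Λ.BoundaryPath) (h : Λ.s f = x.vert 0 (Le.zero _))
    (p q p' q' : Fin k → ℕ) (hpq : p ≤ q) (hq : Le q x.deg) (hpq' : p' ≤ q')
    (hq' : Le q' (fun i => (Λ.d f i : ℕ∞) + x.deg i))
    (ep : p' = Λ.d f + p) (eq : q' = Λ.d f + q) :
    concatSeg f x h p' q' hpq' hq' = x.seg p q hpq hq := by
  subst ep; subst eq
  refine (concatSeg_spec f x h _ _ _ hpq' le_rfl hq').unique ?_
  have e : Λ.d f + q - Λ.d f = q := add_tsub_cancel_left _ _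
  have h1 : Λ.IsComp f (x.seg 0 q zero_le hq) (concatInit f x h _ hq') := by
    rw [x.seg_congr rfl e.symm zero_le hq zero_le (le_tail hq')]
    exact ⟨_, rfl⟩
  refine IsSeg.of_right ?_ h1
  exact ⟨x.seg 0 p zero_le (Le.mono hpq hq), _, _, x.isComp_seg 0 p q zero_le hpq hq,
    isComp_id_right _, by rw [d_seg, tsub_zero], by rw [d_seg, add_tsub_cancel_of_le hpq]⟩

/-- The boundary path `f x`, of degree `d(f) + d(x)`, for `f ∈ Λ` with `s(f) = x(0)`. -/
noncomputable def concat (hΛ : Λ.LocallyConvex) (f : Λ.Path) (x : Λ.BoundaryPath)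
    (h : Λ.s f = x.vert 0 (Le.zero _)) : Λ.BoundaryPath where
  deg := fun i => (Λ.d f i : ℕ∞) + x.deg i
  hom :=
    { obj := fun p => Λ.r (concatSeg f x h p.1 p.1 le_rfl p.2)
      map := fun g => concatSeg f x h g.1.1 g.1.2 g.2.1 g.2.2
      r_map := fun g => (isComp_concatSeg f x h g.1.1 g.1.1 g.1.2 le_rfl g.2.1 g.2.2).r_eq
      s_map := fun g => (isComp_concatSeg f x h g.1.1 g.1.2 g.1.2 g.2.1 le_rfl g.2.2).1
      map_id := fun p => eq_id_of_d_eq_zero (by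
        exact add_eq_left.1 (d_concatSeg f x h p.1 p.1 le_rfl p.2))
      map_comp := fun g g' hg => by
        have h' : g.1.2 = g'.1.1 := Subtype.ext_iff.1 hg
        obtain ⟨⟨p, q⟩, h1, h2⟩ := g
        obtain ⟨⟨q', t⟩, h3, h4⟩ := g'
        replace h' : q = q' := h'
        subst h'
        exact (isComp_concatSeg f x h p q t h1 h3 h4).2.symm
      d_map := fun g => by
        have := d_concatSeg f x h g.1.1 g.1.2 g.2.1 g.2.2
        exact eq_tsub_of_add_eq (by rw [add_comm]; exact this) }
  boundary := by
    intro p hp i hi hrec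
    set q : Fin k → ℕ := p ⊔ Λ.d f with hqdef
    have hpq : p ≤ q := le_sup_left
    have hfq : Λ.d f ≤ q := le_sup_right
    have hq : Le q (fun i => (Λ.d f i : ℕ∞) + x.deg i) := fun j => by
      rcases le_total (p j) (Λ.d f j) with hj | hj
      · have : q j = Λ.d f j := by simp [hqdef, hj]
        rw [this]; exact le_self_add
      · have : q j = p j := by simp [hqdef, hj]
        rw [this]; exact hp j
    have hfi : Λ.d f i ≤ p i := by
      have : (Λ.d f i : ℕ∞) ≤ p i := by rw [hi]; exact le_self_add
      exact_mod_cast this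
    have hqi : q i = p i := by simp [hqdef, hfi]
    have hc := isComp_concatSeg f x h p p q le_rfl hpq hq
    have hd := d_concatSeg f x h p q hpq hq
    have hdi : Λ.d (concatSeg f x h p q hpq hq) i = 0 := by
      have := congrFun hd i
      simp only [Pi.add_apply] at this
      omega
    have h1 := hΛ.receives _ _ rfl hdi (by rw [hc.r_eq]; exact hrec)
    have hc' := isComp_concatSeg f x h p q q hpq le_rfl hq
    have h2 : Λ.s (concatSeg f x h p q hpq hq) = x.vert (q - Λ.d f) (le_tail hq) := by
      rw [hc'.1, concatSeg_right f x h (q - Λ.d f) (q - Λ.d f) q q le_rfl (le_tail hq) le_rfl hq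
        (add_tsub_cancel_of_le hfq).symm (add_tsub_cancel_of_le hfq).symm, r_seg]
    rw [h2] at h1
    refine x.boundary (q - Λ.d f) (le_tail hq) i ?_ h1
    simp only [Pi.sub_apply, ENat.natCast_sub, hqi, hi]
    exact (ENat.addLECancellable_natCast _).add_tsub_cancel_left

/-- The segment of `f x` cut out from the end of `f` and from the beginning of `x`. -/
theorem isComp_concatSeg_mid (f : Λ.Path) (x : Λ.BoundaryPath) (h : Λ.s f = x.vert 0 (Le.zero _))
    (p q : Fin k → ℕ) (hp : p ≤ Λ.d f) (hq : Le q x.deg) (hpq : p ≤ Λ.d f + q)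
    (hq' : Le (Λ.d f + q) (fun i => (Λ.d f i : ℕ∞) + x.deg i)) :
    Λ.IsComp (Λ.seg f p (Λ.d f) hp le_rfl) (x.seg 0 q zero_le hq)
      (concatSeg f x h p (Λ.d f + q) hpq hq') := by
  have h1 := isComp_concatSeg f x h p (Λ.d f) (Λ.d f + q) hp le_self_add hq'
  rw [concatSeg_left f x h _ _ _ _ (seg_spec f p (Λ.d f) hp le_rfl)] at h1
  rwa [concatSeg_right f x h 0 q _ _ zero_le hq _ _ (add_zero _).symm rfl] at h1

/-- Segments of `x(a, b)` are segments of `x`. -/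
theorem isSeg_seg (x : Λ.BoundaryPath) (a p q b : Fin k → ℕ) (hap : a ≤ p) (hpq : p ≤ q)
    (hqb : q ≤ b) (hb : Le b x.deg) :
    Λ.IsSeg (x.seg a b (hap.trans (hpq.trans hqb)) hb) (p - a) (q - a)
      (x.seg p q hpq (Le.mono hqb hb)) :=
  ⟨_, _, _, x.isComp_seg a p q hap hpq (Le.mono hqb hb),
    x.isComp_seg a q b (hap.trans hpq) hqb hb, x.d_seg .., by
      rw [d_seg]
      funext i
      have h1 : a i ≤ p i := hap i
      have h2 : p i ≤ q i := hpq i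
      simp only [Pi.add_apply, Pi.sub_apply]
      omega⟩

end BoundaryPath

/-! ### Removing sources -/

/-- The coordinatewise minimum `n ∧ m` of `n ∈ ℕ^k` and `m ∈ (ℕ ∪ {∞})^k`. -/
noncomputable def cap (n : Fin k → ℕ) (m : Fin k → ℕ∞) : Fin k → ℕ := fun i => (min (n i : ℕ∞) (m i)).toNat

theorem cap_of_top {n : Fin k → ℕ} {m : Fin k → ℕ∞} {i : Fin k} (h : m i = ⊤) :
    cap n m i = n i := by
  simp [cap, h]

theorem cap_of_coe {n : Fin k → ℕ} {m : Fin k → ℕ∞} {i : Fin k} {a : ℕ} (h : m i = a) :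
    cap n m i = min (n i) a := by
  rw [cap, h]
  rcases le_total (n i) a with h' | h'
  · rw [min_eq_left h', min_eq_left (by exact_mod_cast h'), ENat.toNat_natCast]
  · rw [min_eq_right h', min_eq_right (by exact_mod_cast h'), ENat.toNat_natCast]

theorem cap_cases (m : Fin k → ℕ∞) (i : Fin k) :
    (m i = ⊤ ∧ ∀ n, cap n m i = n i) ∨ ∃ a : ℕ, m i = a ∧ ∀ n, cap n m i = min (n i) a := by
  rcases h : m i with _ | a
  · exact Or.inl ⟨rfl, fun n => cap_of_top h⟩
  · exact Or.inr ⟨a, rfl, fun n => cap_of_coe h⟩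

theorem cap_le (n : Fin k → ℕ) (m : Fin k → ℕ∞) : Le (cap n m) m := fun i => by
  rcases cap_cases m i with ⟨h1, h2⟩ | ⟨a, h1, h2⟩
  · rw [h1]; exact le_top
  · rw [h1, h2]; exact_mod_cast min_le_right _ _

theorem cap_mono {p q : Fin k → ℕ} (h : p ≤ q) (m : Fin k → ℕ∞) : cap p m ≤ cap q m := fun i => by
  change cap p m i ≤ cap q m i
  have : p i ≤ q i := h i
  rcases cap_cases m i with ⟨h1, h2⟩ | ⟨a, h1, h2⟩ <;> rw [h2, h2] <;> omega

namespace BoundaryPath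

variable {Λ : KGraph.{u} k}

/-- The path `x(m ∧ d(x), n ∧ d(x))`. -/
noncomputable def capSeg (x : Λ.BoundaryPath) (m n : Fin k → ℕ) (h : m ≤ n) : Λ.Path :=
  x.seg (cap m x.deg) (cap n x.deg) (cap_mono h _) (cap_le _ _)

/-- The vertex `x(m ∧ d(x))`. -/
noncomputable def capVert (x : Λ.BoundaryPath) (m : Fin k → ℕ) : Λ.Vert :=
  x.vert (cap m x.deg) (cap_le _ _)

theorem r_capSeg (x : Λ.BoundaryPath) (m n : Fin k → ℕ) (h : m ≤ n) :
    Λ.r (x.capSeg m n h) = x.capVert m := x.r_seg ..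

theorem s_capSeg (x : Λ.BoundaryPath) (m n : Fin k → ℕ) (h : m ≤ n) :
    Λ.s (x.capSeg m n h) = x.capVert n := x.s_seg ..

end BoundaryPath

section RemoveSources

variable (Λ : KGraph.{u} k)

/-- The set `V_Λ` of pairs `(x; m)` with `x` a boundary path and `m ∈ ℕ^k`. -/
structure PreVert where
  x : Λ.BoundaryPath
  m : Fin k → ℕ

/-- The set `P_Λ` of pairs `(x; (m, n))` with `x` a boundary path and `m ≤ n ∈ ℕ^k`. -/
structure PrePath where
  x : Λ.BoundaryPath
  m : Fin k → ℕ
  n : Fin k → ℕ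
  le : m ≤ n

/-- `(x; m) ∼ (y; n)` if and only if `x(m ∧ d(x)) = y(n ∧ d(y))` and
`m - m ∧ d(x) = n - n ∧ d(y)`. -/
def vertSetoid : Setoid Λ.PreVert where
  r v w := v.x.capVert v.m = w.x.capVert w.m ∧ v.m - cap v.m v.x.deg = w.m - cap w.m w.x.deg
  iseqv :=
    { refl := fun _ => ⟨rfl, rfl⟩
      symm := fun h => ⟨h.1.symm, h.2.symm⟩
      trans := fun h h' => ⟨h.1.trans h'.1, h.2.trans h'.2⟩ }

/-- `(x; (m, n)) ≈ (y; (p, q))` if and only if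
`x(m ∧ d(x), n ∧ d(x)) = y(p ∧ d(y), q ∧ d(y))`, `m - m ∧ d(x) = p - p ∧ d(y)` and
`n - m = q - p`. -/
def pathSetoid : Setoid Λ.PrePath where
  r f g := f.x.capSeg f.m f.n f.le = g.x.capSeg g.m g.n g.le ∧
    f.m - cap f.m f.x.deg = g.m - cap g.m g.x.deg ∧ f.n - f.m = g.n - g.m
  iseqv :=
    { refl := fun _ => ⟨rfl, rfl, rfl⟩
      symm := fun h => ⟨h.1.symm, h.2.1.symm, h.2.2.symm⟩
      trans := fun h h' => ⟨h.1.trans h'.1, h.2.1.trans h'.2.1, h.2.2.trans h'.2.2⟩ }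

/-- The set of objects `V_Λ/∼`. -/
def TVert := Quotient Λ.vertSetoid

/-- The set of morphisms `P_Λ/≈`. -/
def TPath := Quotient Λ.pathSetoid

variable {Λ}

/-- The class `[x; m]`. -/
def vmk (x : Λ.BoundaryPath) (m : Fin k → ℕ) : Λ.TVert := Quotient.mk Λ.vertSetoid ⟨x, m⟩

/-- The class `[x; (m, n)]`. -/
def pmk (x : Λ.BoundaryPath) (m n : Fin k → ℕ) (h : m ≤ n) : Λ.TPath :=
  Quotient.mk Λ.pathSetoid ⟨x, m, n, h⟩

theorem vmk_eq_iff {x y : Λ.BoundaryPath} {m n : Fin k → ℕ} : vmk x m = vmk y n ↔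
    x.capVert m = y.capVert n ∧ m - cap m x.deg = n - cap n y.deg :=
  Quotient.eq (r := Λ.vertSetoid)

theorem pmk_eq_iff {x y : Λ.BoundaryPath} {m n p q : Fin k → ℕ} {h : m ≤ n} {h' : p ≤ q} :
    pmk x m n h = pmk y p q h' ↔ x.capSeg m n h = y.capSeg p q h' ∧
      m - cap m x.deg = p - cap p y.deg ∧ n - m = q - p :=
  Quotient.eq (r := Λ.pathSetoid)

theorem exists_pmk (f : Λ.TPath) : ∃ x m n h, f = pmk (Λ := Λ) x m n h := by
  induction f using Quotient.inductionOn with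
  | h f => exact ⟨f.x, f.m, f.n, f.le, rfl⟩

/-- The range map `[x; (m, n)] ↦ [x; m]`. -/
def tr : Λ.TPath → Λ.TVert :=
  Quotient.lift (fun f => vmk f.x f.m) (by
    rintro ⟨x, m, n, h⟩ ⟨y, p, q, h'⟩ ⟨h1, h2, -⟩
    refine vmk_eq_iff.2 ⟨?_, h2⟩
    have := congrArg Λ.r h1
    rwa [BoundaryPath.r_capSeg, BoundaryPath.r_capSeg] at this)

/-- The source map `[x; (m, n)] ↦ [x; n]`. -/
def ts : Λ.TPath → Λ.TVert :=
  Quotient.lift (fun f => vmk f.x f.n) (by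
    rintro ⟨x, m, n, h⟩ ⟨y, p, q, h'⟩ ⟨h1, h2, h3⟩
    refine vmk_eq_iff.2 ⟨?_, ?_⟩
    · have := congrArg Λ.s h1
      rwa [BoundaryPath.s_capSeg, BoundaryPath.s_capSeg] at this
    · have h4 := congrArg Λ.d h1
      simp only [BoundaryPath.capSeg, BoundaryPath.d_seg] at h4
      funext i
      have e1 : m i ≤ n i := h i
      have e2 : p i ≤ q i := h' i
      have e3 := congrFun h2 i
      have e4 := congrFun h3 i
      have e5 := congrFun h4 i
      simp only [Pi.sub_apply] at e3 e4 e5 ⊢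
      rcases cap_cases x.deg i with ⟨-, h5⟩ | ⟨a, -, h5⟩ <;>
      rcases cap_cases y.deg i with ⟨-, h6⟩ | ⟨b, -, h6⟩ <;>
      simp only [h5, h6] at e3 e5 ⊢ <;> omega)

/-- The degree map `[x; (m, n)] ↦ n - m`. -/
def td : Λ.TPath → (Fin k → ℕ) :=
  Quotient.lift (fun f => f.n - f.m) (by
    rintro ⟨x, m, n, h⟩ ⟨y, p, q, h'⟩ ⟨-, -, h3⟩
    exact h3)

/-- The identity map `[x; m] ↦ [x; (m, m)]`. -/
def tid : Λ.TVert → Λ.TPath :=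
  Quotient.lift (fun v => pmk v.x v.m v.m le_rfl) (by
    rintro ⟨x, m⟩ ⟨y, n⟩ ⟨h1, h2⟩
    refine pmk_eq_iff.2 ⟨?_, h2, by rw [tsub_self, tsub_self]⟩
    have hx : x.capSeg m m le_rfl = Λ.id (x.capVert m) :=
      x.hom.map_id ⟨cap m x.deg, cap_le _ _⟩
    have hy : y.capSeg n n le_rfl = Λ.id (y.capVert n) :=
      y.hom.map_id ⟨cap n y.deg, cap_le _ _⟩
    rw [hx, hy]
    exact congrArg _ h1)

/-- `x(0, n ∧ d(x))` and `σ^{p ∧ d(y)}(y)` are composable if `[x; n] = [y; p]`. -/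
theorem splice_aux {x y : Λ.BoundaryPath} {n p : Fin k → ℕ} (h : vmk x n = vmk y p) :
    Λ.s (x.seg 0 (cap n x.deg) zero_le (cap_le _ _)) =
      (y.shift (cap p y.deg) (cap_le _ _)).vert 0 (Le.zero _) := by
  rw [x.s_seg]
  refine (vmk_eq_iff.1 h).1.trans ?_
  exact y.vert_congr (zero_add _).symm _ _

/-- The boundary path `x(0, n ∧ d(x)) σ^{p ∧ d(y)}(y)`, for `[x; n] = [y; p]`. -/
noncomputable def splice (hΛ : Λ.LocallyConvex) (x y : Λ.BoundaryPath) (n p : Fin k → ℕ)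
    (h : vmk x n = vmk y p) : Λ.BoundaryPath :=
  BoundaryPath.concat hΛ (x.seg 0 (cap n x.deg) zero_le (cap_le _ _))
    (y.shift (cap p y.deg) (cap_le _ _)) (splice_aux h)

/-- The composite `[z; (m, n + q - p)]` of `[x; (m, n)]` and `[y; (p, q)]`, where
`z = x(0, n ∧ d(x)) σ^{p ∧ d(y)}(y)`. -/
noncomputable def preComp (hΛ : Λ.LocallyConvex) (f g : Λ.PrePath)
    (h : vmk f.x f.n = vmk g.x g.m) : Λ.TPath :=
  pmk (splice hΛ f.x g.x f.n g.m h) f.m (f.n + g.n - g.m) (fun i => by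
    have h1 : f.m i ≤ f.n i := f.le i
    have h2 : g.m i ≤ g.n i := g.le i
    simp only [Pi.add_apply, Pi.sub_apply]
    omega)

theorem ts_eq (f : Λ.TPath) : vmk f.out.x f.out.n = ts f := congrArg ts (Quotient.out_eq f)

theorem tr_eq (f : Λ.TPath) : vmk f.out.x f.out.m = tr f := congrArg tr (Quotient.out_eq f)

/-- Composition in `P_Λ/≈`, computed on representatives; it does not depend on their choice
(see `tcomp_pmk`). -/
noncomputable def tcomp (hΛ : Λ.LocallyConvex) (f g : Λ.TPath) (h : ts f = tr g) : Λ.TPath :=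
  preComp hΛ f.out g.out ((ts_eq f).trans (h.trans (tr_eq g).symm))

/-- The projection `[x; (m, n)] ↦ x(m ∧ d(x), n ∧ d(x))`. -/
noncomputable def tproj : Λ.TPath → Λ.Path :=
  Quotient.lift (fun f => f.x.capSeg f.m f.n f.le) fun _ _ h => h.1

/-- The map `[x; (m, n)] ↦ m - m ∧ d(x)`. -/
noncomputable def texc : Λ.TPath → (Fin k → ℕ) :=
  Quotient.lift (fun f => f.m - cap f.m f.x.deg) fun _ _ h => h.2.1

theorem tpath_ext {f g : Λ.TPath} (h1 : tproj f = tproj g) (h2 : texc f = texc g)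
    (h3 : td f = td g) : f = g := by
  obtain ⟨x, m, n, h, rfl⟩ := exists_pmk f
  obtain ⟨y, p, q, h', rfl⟩ := exists_pmk g
  exact pmk_eq_iff.2 ⟨h1, h2, h3⟩

theorem d_tproj_le (f : Λ.TPath) (i : Fin k) : Λ.d (tproj f) i ≤ td f i := by
  obtain ⟨x, m, n, h, rfl⟩ := exists_pmk f
  change Λ.d (x.capSeg m n h) i ≤ n i - m i
  have e : m i ≤ n i := h i
  rw [BoundaryPath.capSeg, BoundaryPath.d_seg]
  simp only [Pi.sub_apply]
  rcases cap_cases x.deg i with ⟨-, h5⟩ | ⟨a, -, h5⟩ <;> simp only [h5] <;> omega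

theorem d_tproj_eq_zero (f : Λ.TPath) (i : Fin k) (hi : texc f i ≠ 0) : Λ.d (tproj f) i = 0 := by
  obtain ⟨x, m, n, h, rfl⟩ := exists_pmk f
  change Λ.d (x.capSeg m n h) i = 0
  change m i - cap m x.deg i ≠ 0 at hi
  have e : m i ≤ n i := h i
  rw [BoundaryPath.capSeg, BoundaryPath.d_seg]
  simp only [Pi.sub_apply]
  rcases cap_cases x.deg i with ⟨-, h5⟩ | ⟨a, -, h5⟩ <;> simp only [h5] at hi ⊢ <;> omega

theorem sub_cap_source (x : Λ.BoundaryPath) (m n : Fin k → ℕ) (h : m ≤ n) :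
    n - cap n x.deg = texc (pmk x m n h) + td (pmk x m n h) - Λ.d (tproj (pmk x m n h)) := by
  change _ = (m - cap m x.deg) + (n - m) - Λ.d (x.capSeg m n h)
  rw [BoundaryPath.capSeg, BoundaryPath.d_seg]
  funext i
  have e : m i ≤ n i := h i
  simp only [Pi.sub_apply, Pi.add_apply]
  rcases cap_cases x.deg i with ⟨-, h5⟩ | ⟨a, -, h5⟩ <;> simp only [h5] <;> omega

theorem tr_eq_tr_iff {f g : Λ.TPath} :
    tr f = tr g ↔ Λ.r (tproj f) = Λ.r (tproj g) ∧ texc f = texc g := by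
  obtain ⟨x, m, n, h, rfl⟩ := exists_pmk f
  obtain ⟨y, p, q, h', rfl⟩ := exists_pmk g
  have e1 : Λ.r (tproj (pmk x m n h)) = x.capVert m := x.r_capSeg m n h
  have e2 : Λ.r (tproj (pmk y p q h')) = y.capVert p := y.r_capSeg p q h'
  rw [e1, e2]
  exact vmk_eq_iff

theorem ts_eq_ts_iff {f g : Λ.TPath} :
    ts f = ts g ↔ Λ.s (tproj f) = Λ.s (tproj g) ∧
      texc f + td f - Λ.d (tproj f) = texc g + td g - Λ.d (tproj g) := by
  obtain ⟨x, m, n, h, rfl⟩ := exists_pmk f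
  obtain ⟨y, p, q, h', rfl⟩ := exists_pmk g
  have e1 : Λ.s (tproj (pmk x m n h)) = x.capVert n := x.s_capSeg m n h
  have e2 : Λ.s (tproj (pmk y p q h')) = y.capVert q := y.s_capSeg p q h'
  rw [e1, e2, ← sub_cap_source, ← sub_cap_source]
  exact vmk_eq_iff

theorem ts_eq_tr_iff {f g : Λ.TPath} :
    ts f = tr g ↔ Λ.s (tproj f) = Λ.r (tproj g) ∧
      texc f + td f - Λ.d (tproj f) = texc g := by
  obtain ⟨x, m, n, h, rfl⟩ := exists_pmk f
  obtain ⟨y, p, q, h', rfl⟩ := exists_pmk g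
  have e1 : Λ.s (tproj (pmk x m n h)) = x.capVert n := x.s_capSeg m n h
  have e2 : Λ.r (tproj (pmk y p q h')) = y.capVert p := y.r_capSeg p q h'
  rw [e1, e2, ← sub_cap_source]
  exact vmk_eq_iff

theorem splice_cap (hΛ : Λ.LocallyConvex) (x y : Λ.BoundaryPath) (m n p q : Fin k → ℕ)
    (h : vmk x n = vmk y p) (hmn : m ≤ n) (hpq : p ≤ q) :
    cap m (splice hΛ x y n p h).deg = cap m x.deg ∧
      cap (n + q - p) (splice hΛ x y n p h).deg =
        cap n x.deg + (cap q y.deg - cap p y.deg) := by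
  have hdeg : ∀ i, (splice hΛ x y n p h).deg i =
      (cap n x.deg i : ℕ∞) + (y.deg i - cap p y.deg i) := fun i => by
    change ((Λ.d (x.seg 0 (cap n x.deg) zero_le (cap_le _ _)) i : ℕ) : ℕ∞) + _ = _
    rw [BoundaryPath.d_seg, tsub_zero]
    rfl
  have hexc := (vmk_eq_iff.1 h).2
  have key : ∀ i, cap m (splice hΛ x y n p h).deg i = cap m x.deg i ∧
      cap (n + q - p) (splice hΛ x y n p h).deg i =
        cap n x.deg i + (cap q y.deg i - cap p y.deg i) := by
    intro i
    have e1 : m i ≤ n i := hmn i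
    have e2 : p i ≤ q i := hpq i
    have e3 : n i - cap n x.deg i = p i - cap p y.deg i := congrFun hexc i
    have e4 : (n + q - p) i = n i + q i - p i := rfl
    rcases cap_cases y.deg i with ⟨h5, h6⟩ | ⟨b, h5, h6⟩
    · have hz : (splice hΛ x y n p h).deg i = ⊤ := by
        rw [hdeg, h5]; simp
      rw [cap_of_top hz, cap_of_top hz, h6, h6, e4]
      rw [h6] at e3
      rcases cap_cases x.deg i with ⟨-, h8⟩ | ⟨a, -, h8⟩ <;>
      · have a1 := h8 m
        have a2 := h8 n
        omega
    · have hz : (splice hΛ x y n p h).deg i = ((cap n x.deg i + (b - cap p y.deg i) : ℕ) : ℕ∞) := by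
        rw [hdeg, h5]; push_cast; rfl
      rw [cap_of_coe hz, cap_of_coe hz, h6, h6, e4]
      rw [h6] at e3
      rcases cap_cases x.deg i with ⟨-, h8⟩ | ⟨a, -, h8⟩ <;>
      · have a1 := h8 m
        have a2 := h8 n
        omega
  exact ⟨funext fun i => (key i).1, funext fun i => (key i).2⟩

theorem preComp_spec (hΛ : Λ.LocallyConvex) (f g : Λ.PrePath)
    (h : vmk f.x f.n = vmk g.x g.m) :
    Λ.IsComp (f.x.capSeg f.m f.n f.le) (g.x.capSeg g.m g.n g.le) (tproj (preComp hΛ f g h)) ∧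
      texc (preComp hΛ f g h) = f.m - cap f.m f.x.deg ∧
      td (preComp hΛ f g h) = (f.n - f.m) + (g.n - g.m) := by
  obtain ⟨x, m, n, hmn⟩ := f
  obtain ⟨y, p, q, hpq⟩ := g
  obtain ⟨h1, h2⟩ := splice_cap hΛ x y m n p q h hmn hpq
  refine ⟨?_, ?_, ?_⟩
  · have hN := x.d_seg 0 (cap n x.deg) zero_le (cap_le _ _)
    rw [tsub_zero] at hN
    have hP : cap p y.deg ≤ cap q y.deg := cap_mono hpq _
    have hM : cap m x.deg ≤ cap n x.deg := cap_mono hmn _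
    have hq : Le (cap q y.deg - cap p y.deg) (y.shift (cap p y.deg) (cap_le _ _)).deg :=
      fun i => by
        change (((cap q y.deg i - cap p y.deg i : ℕ)) : ℕ∞) ≤ y.deg i - cap p y.deg i
        rw [ENat.natCast_sub]
        exact tsub_le_tsub_right (cap_le q y.deg i) _
    have hle : cap m x.deg ≤ Λ.d (x.seg 0 (cap n x.deg) zero_le (cap_le _ _)) := by rwa [hN]
    have key := BoundaryPath.isComp_concatSeg_mid (x.seg 0 (cap n x.deg) zero_le (cap_le _ _))
      (y.shift (cap p y.deg) (cap_le _ _)) (splice_aux h) (cap m x.deg)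
      (cap q y.deg - cap p y.deg) hle hq (hle.trans le_self_add) (fun i => by
        have := hq i
        simp only [Pi.add_apply, Nat.cast_add]
        gcongr)
    have k1 : Λ.seg (x.seg 0 (cap n x.deg) zero_le (cap_le _ _)) (cap m x.deg)
        (Λ.d (x.seg 0 (cap n x.deg) zero_le (cap_le _ _))) hle le_rfl = x.capSeg m n hmn := by
      refine (seg_spec _ _ _ _ _).unique ?_
      have := x.isSeg_seg 0 (cap m x.deg) (cap n x.deg) (cap n x.deg) zero_le hM le_rfl
        (cap_le _ _)
      rw [tsub_zero, tsub_zero] at this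
      rwa [hN]
    have k2 : (y.shift (cap p y.deg) (cap_le _ _)).seg 0 (cap q y.deg - cap p y.deg) zero_le hq =
        y.capSeg p q hpq :=
      y.seg_congr (zero_add _) (tsub_add_cancel_of_le hP)
        ((zero_add _).le.trans (hP.trans (tsub_add_cancel_of_le hP).ge))
        (by rw [tsub_add_cancel_of_le hP]; exact cap_le _ _) _ _
    rw [k1, k2] at key
    have k3 : tproj (preComp hΛ ⟨x, m, n, hmn⟩ ⟨y, p, q, hpq⟩ h) =
        (splice hΛ x y n p h).seg (cap m x.deg)
          (Λ.d (x.seg 0 (cap n x.deg) zero_le (cap_le _ _)) + (cap q y.deg - cap p y.deg))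
          (hle.trans le_self_add) (fun i => by
            have := hq i
            change ((_ + _ : ℕ) : ℕ∞) ≤ _ + _
            rw [Nat.cast_add]
            gcongr) :=
      (splice hΛ x y n p h).seg_congr h1 (by rw [hN]; exact h2)
        (cap_mono (p := m) (q := n + q - p) (fun i => by
          have e1 : m i ≤ n i := hmn i
          have e2 : p i ≤ q i := hpq i
          change m i ≤ n i + q i - p i
          omega) _) (cap_le _ _) _ _
    rw [k3]
    exact key
  · change m - cap m (splice hΛ x y n p h).deg = _
    rw [h1]
  · funext i
    have e1 : m i ≤ n i := hmn i
    have e2 : p i ≤ q i := hpq i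
    change n i + q i - p i - m i = (n i - m i) + (q i - p i)
    omega

theorem tcomp_spec (hΛ : Λ.LocallyConvex) (f g : Λ.TPath) (h : ts f = tr g) :
    Λ.IsComp (tproj f) (tproj g) (tproj (tcomp hΛ f g h)) ∧
      texc (tcomp hΛ f g h) = texc f ∧ td (tcomp hΛ f g h) = td f + td g := by
  have e := preComp_spec hΛ f.out g.out ((ts_eq f).trans (h.trans (tr_eq g).symm))
  have ef := Quotient.out_eq f
  have eg := Quotient.out_eq g
  have e1 : f.out.x.capSeg f.out.m f.out.n f.out.le = tproj f := congrArg tproj ef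
  have e2 : g.out.x.capSeg g.out.m g.out.n g.out.le = tproj g := congrArg tproj eg
  have e3 : f.out.m - cap f.out.m f.out.x.deg = texc f := congrArg texc ef
  have e4 : f.out.n - f.out.m = td f := congrArg td ef
  have e5 : g.out.n - g.out.m = td g := congrArg td eg
  rw [e1, e2, e3, e4, e5] at e
  exact e

/-- The composition formula
`[x; (m, n)] [y; (p, q)] = [x(0, n ∧ d(x)) σ^{p ∧ d(y)}(y); (m, n + q - p)]`, valid for all
representatives. -/
theorem tcomp_pmk (hΛ : Λ.LocallyConvex) (f g : Λ.PrePath)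
    (h : vmk f.x f.n = vmk g.x g.m) :
    tcomp hΛ (pmk f.x f.m f.n f.le) (pmk g.x g.m g.n g.le) h = preComp hΛ f g h := by
  obtain ⟨h1, h2, h3⟩ := tcomp_spec hΛ (pmk f.x f.m f.n f.le) (pmk g.x g.m g.n g.le) h
  obtain ⟨h1', h2', h3'⟩ := preComp_spec hΛ f g h
  exact tpath_ext (h1.unique h1') (h2.trans h2'.symm) (h3.trans h3'.symm)

theorem tr_tid (v : Λ.TVert) : tr (tid v) = v := by
  induction v using Quotient.inductionOn with
  | h v => rfl

theorem ts_tid (v : Λ.TVert) : ts (tid v) = v := by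
  induction v using Quotient.inductionOn with
  | h v => rfl

theorem td_tid (v : Λ.TVert) : td (tid v) = 0 := by
  induction v using Quotient.inductionOn with
  | h v => exact tsub_self v.m

theorem tproj_tid (v : Λ.TVert) : ∃ a, tproj (tid v) = Λ.id a := by
  induction v using Quotient.inductionOn with
  | h v => exact ⟨_, v.x.hom.map_id ⟨cap v.m v.x.deg, cap_le _ _⟩⟩

theorem tr_tcomp (hΛ : Λ.LocallyConvex) (f g : Λ.TPath) (h : ts f = tr g) :
    tr (tcomp hΛ f g h) = tr f := by
  obtain ⟨h1, h2, h3⟩ := tcomp_spec hΛ f g h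
  exact tr_eq_tr_iff.2 ⟨h1.r_eq, h2⟩

theorem ts_tcomp (hΛ : Λ.LocallyConvex) (f g : Λ.TPath) (h : ts f = tr g) :
    ts (tcomp hΛ f g h) = ts g := by
  obtain ⟨h1, h2, h3⟩ := tcomp_spec hΛ f g h
  refine ts_eq_ts_iff.2 ⟨h1.s_eq, ?_⟩
  rw [h2, h3, h1.d_eq, ← (ts_eq_tr_iff.1 h).2]
  funext i
  have e1 := d_tproj_le f i
  have e2 := d_tproj_le g i
  simp only [Pi.add_apply, Pi.sub_apply]
  omega

/-- The degrees of the projections of two composable paths are determined by their degrees and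
by their composite. -/
theorem d_tproj_left (f g : Λ.TPath) (h : ts f = tr g) (i : Fin k) :
    Λ.d (tproj f) i = min (td f i) (Λ.d (tproj f) i + Λ.d (tproj g) i) := by
  have e1 := d_tproj_le f i
  have e2 := d_tproj_eq_zero g i
  have e3 : texc f i + td f i - Λ.d (tproj f) i = texc g i := congrFun (ts_eq_tr_iff.1 h).2 i
  omega

theorem tcomp_cancel (hΛ : Λ.LocallyConvex) (f g f' g' : Λ.TPath) (h : ts f = tr g)
    (h' : ts f' = tr g') (hf : td f = td f') (hg : td g = td g')
    (H : tcomp hΛ f g h = tcomp hΛ f' g' h') : f = f' ∧ g = g' := by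
  obtain ⟨h1, h2, h3⟩ := tcomp_spec hΛ f g h
  obtain ⟨h1', h2', h3'⟩ := tcomp_spec hΛ f' g' h'
  rw [H] at h1 h2
  have hd : Λ.d (tproj f) = Λ.d (tproj f') := by
    have e := h1.d_eq.symm.trans h1'.d_eq
    funext i
    rw [d_tproj_left f g h i, d_tproj_left f' g' h' i, hf]
    exact congrArg _ (congrFun e i)
  obtain ⟨e1, e2⟩ := h1.cancel h1' hd
  have e3 : texc f = texc f' := h2.symm.trans h2'
  refine ⟨tpath_ext e1 e3 hf, tpath_ext e2 ?_ hg⟩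
  rw [← (ts_eq_tr_iff.1 h).2, ← (ts_eq_tr_iff.1 h').2, e1, e3, hf]

variable (Λ) in
/-- The `k`-graph `Λ̃` obtained from a locally convex `k`-graph `Λ` by removing sources: its
objects are the classes `[x; m]`, its morphisms the classes `[x; (m, n)]`, with
`r[x; (m, n)] = [x; m]`, `s[x; (m, n)] = [x; n]`, `id[x; m] = [x; (m, m)]`,
`d[x; (m, n)] = n - m` and
`[x; (m, n)] [y; (p, q)] = [x(0, n ∧ d(x)) σ^{p ∧ d(y)}(y); (m, n + q - p)]`. -/
noncomputable def removeSources (hΛ : Λ.LocallyConvex) : KGraph.{u} k where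
  Vert := Λ.TVert
  Path := Λ.TPath
  r := tr
  s := ts
  id := tid
  comp := tcomp hΛ
  d := td
  r_id := tr_tid
  s_id := ts_tid
  r_comp := tr_tcomp hΛ
  s_comp := ts_tcomp hΛ
  id_comp f := by
    obtain ⟨h1, h2, h3⟩ := tcomp_spec hΛ (tid (tr f)) f (ts_tid _)
    obtain ⟨a, ha⟩ := tproj_tid (tr f)
    refine tpath_ext ?_ ?_ ?_
    · have hs := h1.1
      rw [ha] at h1 hs
      rw [Λ.s_id] at hs
      subst hs
      exact h1.unique (isComp_id_left _)
    · exact h2.trans (tr_eq_tr_iff.1 (tr_tid (tr f))).2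
    · rw [h3, td_tid, zero_add]
  comp_id f := by
    obtain ⟨h1, h2, h3⟩ := tcomp_spec hΛ f (tid (ts f)) (tr_tid _).symm
    obtain ⟨a, ha⟩ := tproj_tid (ts f)
    refine tpath_ext ?_ h2 ?_
    · have hs := h1.1
      rw [ha] at h1 hs
      rw [Λ.r_id] at hs
      subst hs
      exact h1.unique (isComp_id_right _)
    · rw [h3, td_tid, add_zero]
  assoc f g h hfg hgh := by
    obtain ⟨a1, a2, a3⟩ := tcomp_spec hΛ f g hfg
    obtain ⟨b1, b2, b3⟩ := tcomp_spec hΛ g h hgh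
    obtain ⟨c1, c2, c3⟩ := tcomp_spec hΛ (tcomp hΛ f g hfg) h ((ts_tcomp hΛ f g hfg).trans hgh)
    obtain ⟨e1, e2, e3⟩ := tcomp_spec hΛ f (tcomp hΛ g h hgh)
      (hfg.trans (tr_tcomp hΛ g h hgh).symm)
    refine tpath_ext ?_ ?_ ?_
    · obtain ⟨m, m1, m2⟩ := a1.assoc c1
      obtain rfl := m1.unique b1
      exact m2.unique e1
    · rw [c2, a2, e2]
    · rw [c3, a3, e3, b3, add_assoc]
  countable_path := by
    have := Λ.countable_path
    have hinj : Function.Injective (fun f : Λ.TPath => (tproj f, texc f, td f)) := fun f g h => by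
      simp only [Prod.mk.injEq] at h
      exact tpath_ext h.1 h.2.1 h.2.2
    exact hinj.countable
  d_id := td_tid
  d_comp f g h := (tcomp_spec hΛ f g h).2.2
  factorisation f a b hd := by
    obtain ⟨x, m, n, hmn, rfl⟩ := exists_pmk f
    replace hd : n - m = a + b := hd
    have hn : n = m + a + b := by rw [add_assoc, ← hd, add_tsub_cancel_of_le hmn]
    subst hn
    have l1 : m ≤ m + a := le_self_add
    have l2 : m + a ≤ m + a + b := le_self_add
    have d1 : td (pmk x m (m + a) l1) = a := add_tsub_cancel_left m a
    have d2 : td (pmk x (m + a) (m + a + b) l2) = b := add_tsub_cancel_left (m + a) b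
    obtain ⟨h1, h2, h3⟩ := tcomp_spec hΛ (pmk x m (m + a) l1) (pmk x (m + a) (m + a + b) l2) rfl
    have hc : tcomp hΛ (pmk x m (m + a) l1) (pmk x (m + a) (m + a + b) l2) rfl =
        pmk x m (m + a + b) hmn := by
      refine tpath_ext (h1.unique ?_) h2 ?_
      · exact x.isComp_seg _ _ _ (cap_mono l1 _) (cap_mono l2 _) (cap_le _ _)
      · rw [h3, d1, d2]; exact hd.symm
    refine ⟨(_, _), ⟨d1, d2, rfl, hc⟩, ?_⟩
    rintro ⟨g1, g2⟩ ⟨e1, e2, hs, e3⟩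
    obtain ⟨rfl, rfl⟩ := tcomp_cancel hΛ g1 g2 _ _ hs rfl (e1.trans d1.symm) (e2.trans d2.symm)
      (e3.trans hc.symm)
    rfl

end RemoveSources

end KGraph

/-! A path `[x; (m, n)]` of `Λ̃` is determined by three data: its projection `tproj` to `Λ`, its
excess `texc`, which is `m - m ∧ d(x)`, and its degree. Likewise a vertex `[y; m]` is a vertex of
`Λ` together with an excess `m - m ∧ d(y)`, and the excess is non-zero only in directions in which
that vertex of `Λ` receives no edge. Cofinality is compared through a dictionary between boundary
paths of `Λ` and infinite paths of `Λ̃`.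

A boundary path `x` gives the infinite path `(p, q) ↦ [x; (p, q)]` (`liftPath`). Conversely, the
projections of the initial segments of an infinite path `z` form an increasing sequence whose limit
`projPath z` is a boundary path, and `z(n) = [projPath z; t + n]`, where `t` is the excess of `z(0)`
(`exists_obj_eq_vmk`).

If `Λ̃` is cofinal, choose a boundary path `y` starting at the given vertex (`exists_boundaryPath`)
and project a path from `[y; 0]` to a vertex of `liftPath x`. If `Λ` is cofinal, take `f ∈ Λ` from
the vertex under `[y; m]` to `x(n)`. The boundary path `w = f σⁿ(x)` then carries a path of `Λ̃`
that starts at `[y; m] = [w; e]`, where `e` is the excess, and ends on `z`.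

Local convexity makes limits and concatenations boundary paths: it carries an edge in direction `i`
along any path whose degree vanishes at `i`. Finally, every vertex of `Λ̃` receives edges in all
directions, so its boundary paths are exactly its infinite paths, and the two forms of cofinality
agree. -/

namespace KGraph

variable {k : ℕ} {Λ : KGraph.{u} k}

/-! ### Boundary paths as limits of increasing sequences of paths -/

section Limit

/-- The degree of the limit of a sequence of paths. -/
noncomputable def limitDeg (f : ℕ → Λ.Path) : Fin k → ℕ∞ := fun i => ⨆ j, (Λ.d (f j) i : ℕ∞)

/-- Each path of the sequence `f` is an initial segment of the next one. -/
def IsChainOfPaths (f : ℕ → Λ.Path) : Prop := ∀ j, ∃ g, Λ.IsComp (f j) g (f (j + 1))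

variable {f : ℕ → Λ.Path}

theorem IsChainOfPaths.exists_isComp (hf : IsChainOfPaths f) {i j : ℕ} (hij : i ≤ j) :
    ∃ g, Λ.IsComp (f i) g (f j) := by
  induction j, hij using Nat.le_induction with
  | base => exact ⟨_, isComp_id_right _⟩
  | succ j _ ih =>
    obtain ⟨g, hg⟩ := ih
    obtain ⟨g', hg'⟩ := hf j
    obtain ⟨c, -, hc⟩ := hg.assoc hg'
    exact ⟨c, hc⟩

theorem IsChainOfPaths.d_mono (hf : IsChainOfPaths f) {i j : ℕ} (hij : i ≤ j) :
    Λ.d (f i) ≤ Λ.d (f j) := by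
  obtain ⟨g, hg⟩ := hf.exists_isComp hij
  rw [hg.d_eq]
  exact le_self_add

theorem IsChainOfPaths.isSeg_mono (hf : IsChainOfPaths f) {i j : ℕ} (hij : i ≤ j)
    {p q : Fin k → ℕ} {b : Λ.Path} (H : Λ.IsSeg (f i) p q b) : Λ.IsSeg (f j) p q b := by
  obtain ⟨g, hg⟩ := hf.exists_isComp hij
  exact H.of_left hg

theorem IsChainOfPaths.isSeg_unique (hf : IsChainOfPaths f) {i j : ℕ} {p q : Fin k → ℕ}
    {b b' : Λ.Path} (H : Λ.IsSeg (f i) p q b) (H' : Λ.IsSeg (f j) p q b') : b = b' :=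
  (hf.isSeg_mono (le_max_left i j) H).unique (hf.isSeg_mono (le_max_right i j) H')

theorem d_le_limitDeg (f : ℕ → Λ.Path) (j : ℕ) : Le (Λ.d (f j)) (limitDeg f) :=
  fun i => le_iSup (fun j => (Λ.d (f j) i : ℕ∞)) j

theorem IsChainOfPaths.exists_le_d (hf : IsChainOfPaths f) {q : Fin k → ℕ}
    (hq : Le q (limitDeg f)) : ∃ j, q ≤ Λ.d (f j) := by
  have h : ∀ i, ∃ j, q i ≤ Λ.d (f j) i := by
    -- If no term reached `q i`, the supremum would be at most `q i - 1`. The term of index `0`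
    -- shows `q i > 0`, so the truncated subtraction is genuine.
    intro i
    by_contra! hc
    have h0 := hc 0
    have h1 : limitDeg f i ≤ ((q i - 1 : ℕ) : ℕ∞) :=
      iSup_le fun j => by exact_mod_cast Nat.le_sub_one_of_lt (hc j)
    have h2 : q i ≤ q i - 1 := by exact_mod_cast (hq i).trans h1
    omega
  choose J hJ using h
  exact ⟨Finset.univ.sup J, fun i =>
    (hJ i).trans (hf.d_mono (Finset.le_sup (Finset.mem_univ i)) i)⟩

theorem IsChainOfPaths.exists_isSeg (hf : IsChainOfPaths f) (p q : Fin k → ℕ) (hpq : p ≤ q)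
    (hq : Le q (limitDeg f)) : ∃ b j, Λ.IsSeg (f j) p q b := by
  obtain ⟨j, hj⟩ := hf.exists_le_d hq
  obtain ⟨b, hb⟩ := KGraph.exists_isSeg (f j) p q hpq hj
  exact ⟨b, j, hb⟩

/-- The segment of the limit of `f` between `p` and `q`. -/
noncomputable def limitSeg (hf : IsChainOfPaths f) (p q : Fin k → ℕ) (hpq : p ≤ q)
    (hq : Le q (limitDeg f)) : Λ.Path :=
  (hf.exists_isSeg p q hpq hq).choose

theorem isSeg_limitSeg (hf : IsChainOfPaths f) (p q : Fin k → ℕ) (hpq : p ≤ q)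
    (hq : Le q (limitDeg f)) {j : ℕ} (hj : q ≤ Λ.d (f j)) :
    Λ.IsSeg (f j) p q (limitSeg hf p q hpq hq) := by
  obtain ⟨l, hl⟩ := (hf.exists_isSeg p q hpq hq).choose_spec
  obtain ⟨b, hb⟩ := KGraph.exists_isSeg (f j) p q hpq hj
  rwa [limitSeg, hf.isSeg_unique hl hb]

theorem isComp_limitSeg (hf : IsChainOfPaths f) (p q t : Fin k → ℕ) (hpq : p ≤ q) (hqt : q ≤ t)
    (ht : Le t (limitDeg f)) :
    Λ.IsComp (limitSeg hf p q hpq (Le.mono hqt ht)) (limitSeg hf q t hqt ht)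
      (limitSeg hf p t (hpq.trans hqt) ht) := by
  obtain ⟨j, hj⟩ := hf.exists_le_d ht
  obtain ⟨g, h1, h2⟩ := (isSeg_limitSeg hf p q hpq (Le.mono hqt ht) (hqt.trans hj)).trans
    (isSeg_limitSeg hf q t hqt ht hj)
  rwa [h2.unique (isSeg_limitSeg hf p t (hpq.trans hqt) ht hj)] at h1

theorem d_limitSeg (hf : IsChainOfPaths f) (p q : Fin k → ℕ) (hpq : p ≤ q)
    (hq : Le q (limitDeg f)) : p + Λ.d (limitSeg hf p q hpq hq) = q := by
  obtain ⟨j, hj⟩ := hf.exists_le_d hq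
  exact (isSeg_limitSeg hf p q hpq hq hj).d_add

/-- The limit of an increasing sequence of paths, as a functor. -/
noncomputable def limitHom (hf : IsChainOfPaths f) : Hom (Omega k (limitDeg f)) Λ where
  obj p := Λ.r (limitSeg hf p.1 p.1 le_rfl p.2)
  map g := limitSeg hf g.1.1 g.1.2 g.2.1 g.2.2
  r_map g := (isComp_limitSeg hf g.1.1 g.1.1 g.1.2 le_rfl g.2.1 g.2.2).r_eq
  s_map g := (isComp_limitSeg hf g.1.1 g.1.2 g.1.2 g.2.1 le_rfl g.2.2).1
  map_id p := eq_id_of_d_eq_zero (add_eq_left.1 (d_limitSeg hf p.1 p.1 le_rfl p.2))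
  map_comp g g' hg := by
    have h' : g.1.2 = g'.1.1 := Subtype.ext_iff.1 hg
    obtain ⟨⟨p, q⟩, h1, h2⟩ := g
    obtain ⟨⟨q', t⟩, h3, h4⟩ := g'
    replace h' : q = q' := h'
    subst h'
    exact (isComp_limitSeg hf p q t h1 h3 h4).2.symm
  d_map g := eq_tsub_of_add_eq (by
    rw [add_comm]; exact d_limitSeg hf g.1.1 g.1.2 g.2.1 g.2.2)

/-- The limit of an increasing sequence of paths is a boundary path if in each direction in
which the degrees are eventually constant, some late source receives no edge. -/
noncomputable def limit (hΛ : Λ.LocallyConvex) (hf : IsChainOfPaths f)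
    (hb : ∀ i J, (∀ j, J ≤ j → Λ.d (f j) i = Λ.d (f J) i) →
      ∃ j, J ≤ j ∧ ¬ Λ.Receives (Λ.s (f j)) (Pi.single i 1)) : Λ.BoundaryPath where
  deg := limitDeg f
  hom := limitHom hf
  boundary p hp i hi hrec := by
    obtain ⟨J, hJ⟩ := hf.exists_le_d hp
    -- From index `J` on, the `i`-th degree is squeezed between `p i` and the supremum, which is
    -- also `p i`.
    have hconst : ∀ j, J ≤ j → Λ.d (f j) i = p i := fun j hj => by
      refine le_antisymm ?_ ((hJ i).trans (hf.d_mono hj i))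
      have := d_le_limitDeg f j i
      rw [← hi] at this
      exact_mod_cast this
    obtain ⟨j, hj, hn⟩ := hb i J fun j hj => (hconst j hj).trans (hconst J le_rfl).symm
    have hpj : p ≤ Λ.d (f j) := hJ.trans (hf.d_mono hj)
    have hl := d_le_limitDeg f j
    have hd := congrFun (d_limitSeg hf p (Λ.d (f j)) hpj hl) i
    have hdi : Λ.d (limitSeg hf p (Λ.d (f j)) hpj hl) i = 0 := by
      have := hconst j hj
      simp only [Pi.add_apply] at hd
      omega
    -- The segment from `p` to `d(f j)` has degree zero at `i`, so local convexity moves the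
    -- supposed edge from the vertex at `p` to the source of `f j`.
    have h1 := hΛ.receives _ _ rfl hdi (by
      rw [(isComp_limitSeg hf p p _ le_rfl hpj hl).r_eq]; exact hrec)
    rw [← (isComp_limitSeg hf 0 p _ zero_le hpj hl).s_eq,
      (isSeg_limitSeg hf 0 _ _ hl le_rfl).unique (isSeg_self (f j))] at h1
    exact hn h1

end Limit

/-! ### Existence of boundary paths -/

open Classical in
/-- Extend `f` by an edge in the direction numbered `i`, if possible. -/
noncomputable def extendPath (i : ℕ) (f : Λ.Path) : Λ.Path :=
  if h : ∃ g : Λ.Path, (∃ i' : Fin k, i'.val = i ∧ Λ.d g = Pi.single i' 1) ∧ Λ.s f = Λ.r g then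
    Λ.comp f h.choose h.choose_spec.2
  else f

theorem exists_isComp_extendPath (i : ℕ) (f : Λ.Path) : ∃ g, Λ.IsComp f g (extendPath i f) := by
  unfold extendPath
  split_ifs with h
  · exact ⟨_, _, rfl⟩
  · exact ⟨_, isComp_id_right f⟩

/-- The edge that is appended is an arbitrary choice, but its direction is prescribed, and only the
direction matters for the degree. -/
theorem d_extendPath (i : Fin k) (f : Λ.Path) (h : Λ.Receives (Λ.s f) (Pi.single i 1)) :
    Λ.d (extendPath i f) i = Λ.d f i + 1 := by
  obtain ⟨g, h1, h2⟩ := h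
  have H : ∃ g : Λ.Path, (∃ i' : Fin k, i'.val = i.val ∧ Λ.d g = Pi.single i' 1) ∧
    Λ.s f = Λ.r g := ⟨g, ⟨i, rfl, h2⟩, h1.symm⟩
  rw [extendPath, dif_pos H, Λ.d_comp]
  obtain ⟨i', h3, h4⟩ := H.choose_spec.1
  obtain rfl := Fin.ext h3
  simp [h4]

/-- A sequence of paths with range `a`, extended in every direction infinitely often. -/
noncomputable def greedyPath (a : Λ.Vert) : ℕ → Λ.Path
  | 0 => Λ.id a
  -- The first component of `j.unpair` takes every natural value infinitely often; values that are
  -- at least `k` leave the path unchanged.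
  | j + 1 => extendPath j.unpair.1 (greedyPath a j)

theorem isChainOfPaths_greedyPath (a : Λ.Vert) : IsChainOfPaths (greedyPath a) :=
  fun _ => exists_isComp_extendPath _ _

/-- Extending greedily and fairly suffices: a direction in which the degree stops growing was tried
later and found to have no edge. -/
theorem exists_boundaryPath (hΛ : Λ.LocallyConvex) (a : Λ.Vert) :
    ∃ x : Λ.BoundaryPath, x.vert 0 (Le.zero _) = a := by
  have hf := isChainOfPaths_greedyPath a
  -- Direction `i` is tried at stage `Nat.pair i J`, which is at least `J`; an available edge would
  -- raise the degree after `J`.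
  refine ⟨limit hΛ hf fun i J hJ => ⟨Nat.pair i J, Nat.right_le_pair _ _, fun hrec => ?_⟩, ?_⟩
  · have h1 := d_extendPath i _ hrec
    have h2 : extendPath i (greedyPath a (Nat.pair i J)) = greedyPath a (Nat.pair i J + 1) := by
      rw [greedyPath, Nat.unpair_pair]
    rw [h2, hJ _ (Nat.right_le_pair _ _),
      hJ _ ((Nat.right_le_pair i J).trans (Nat.le_succ _))] at h1
    omega
  · have h0 : Λ.d (greedyPath a 0) = 0 := Λ.d_id a
    have h1 := isSeg_limitSeg hf 0 0 le_rfl (Le.zero _) (j := 0) zero_le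
    have h2 := isSeg_self (greedyPath a 0)
    rw [h0] at h2
    exact (congrArg Λ.r (h1.unique h2)).trans (Λ.r_id a)

/-! ### Vertices of `Λ̃` -/

section RemoveSources

/-- A non-zero excess at `i` means that `m ∧ d(y)` has already reached `d(y)` in direction `i`,
where the boundary condition applies. -/
theorem not_receives_of_cap_lt (y : Λ.BoundaryPath) (m : Fin k → ℕ) (i : Fin k)
    (h : m i - cap m y.deg i ≠ 0) : ¬ Λ.Receives (y.capVert m) (Pi.single i 1) := by
  refine y.boundary _ (cap_le _ _) i ?_
  rcases cap_cases y.deg i with ⟨h1, h2⟩ | ⟨a, h1, h2⟩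
  · rw [h2] at h; omega
  · rw [h2] at h ⊢
    rw [h1]
    have : min (m i) a = a := by omega
    rw [this]

/-- `[y; m]` depends only on `y(m ∧ d(y))` and `m - m ∧ d(y)`. -/
theorem vmk_eq_vmk_of_vert_zero (y w : Λ.BoundaryPath) (m : Fin k → ℕ)
    (h : w.vert 0 (Le.zero _) = y.capVert m) : vmk y m = vmk w (m - cap m y.deg) := by
  -- The whole excess must remain excess for `w`. Where it is non-zero, `w(0) = y(m ∧ d(y))`
  -- receives no edge in that direction, so `d(w)` vanishes there; otherwise `w(0, e_i)` would be
  -- such an edge.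
  have hcap : cap (m - cap m y.deg) w.deg = 0 := by
    funext i
    by_cases hi : m i - cap m y.deg i = 0
    · rcases cap_cases w.deg i with ⟨-, h2⟩ | ⟨a, -, h2⟩ <;> simp [h2, hi]
    · have hw : w.deg i = ((0 : ℕ) : ℕ∞) := by
        by_contra hne
        have hle : Le (Pi.single i 1 : Fin k → ℕ) w.deg := fun j => by
          by_cases hj : j = i
          · subst hj
            simpa using Order.one_le_iff_pos.2 (pos_iff_ne_zero.2 hne)
          · simp [hj]
        refine not_receives_of_cap_lt y m i hi ⟨w.seg 0 _ zero_le hle, ?_, ?_⟩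
        · rw [w.r_seg, ← h]
        · rw [w.d_seg, tsub_zero]
      rw [cap_of_coe hw]
      simp
  refine vmk_eq_iff.2 ⟨?_, ?_⟩
  · rw [← h]
    exact w.vert_congr hcap.symm _ _
  · rw [hcap, tsub_zero]

theorem cap_add (n l : Fin k → ℕ) (D : Fin k → ℕ∞) :
    cap (n + l) (fun i => (n i : ℕ∞) + D i) = n + cap l D := by
  funext i
  rcases cap_cases D i with ⟨h1, h2⟩ | ⟨a, h1, h2⟩
  · rw [Pi.add_apply, h2]
    exact cap_of_top (by simp [h1])
  · rw [Pi.add_apply, h2, cap_of_coe (a := n i + a) (by simp [h1])]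
    simp only [Pi.add_apply]
    omega

/-- `[f x; d(f) + l] = [x; l]`. -/
theorem vmk_concat (hΛ : Λ.LocallyConvex) (f : Λ.Path) (x : Λ.BoundaryPath)
    (h : Λ.s f = x.vert 0 (Le.zero _)) (l : Fin k → ℕ) :
    vmk (BoundaryPath.concat hΛ f x h) (Λ.d f + l) = vmk x l := by
  have hc : cap (Λ.d f + l) (BoundaryPath.concat hΛ f x h).deg = Λ.d f + cap l x.deg :=
    cap_add _ _ _
  refine vmk_eq_iff.2 ⟨?_, ?_⟩
  · change Λ.r (BoundaryPath.concatSeg f x h _ _ le_rfl _) = _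
    rw [BoundaryPath.concatSeg_right f x h (cap l x.deg) (cap l x.deg) _ _ le_rfl (cap_le _ _) _ _
      hc hc, x.r_seg]
    rfl
  · rw [hc, add_tsub_add_eq_tsub_left]

/-- `[σⁿ(x); l] = [x; n + l]`. -/
theorem vmk_shift (x : Λ.BoundaryPath) (n : Fin k → ℕ) (hn : Le n x.deg) (l : Fin k → ℕ) :
    vmk (x.shift n hn) l = vmk x (n + l) := by
  have hc : cap (n + l) x.deg = n + cap l (x.shift n hn).deg := by
    rw [← cap_add]
    congr 1
    funext i
    exact (add_tsub_cancel_of_le (hn i)).symm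
  refine vmk_eq_iff.2 ⟨x.vert_congr (by rw [hc, add_comm]) _ _, ?_⟩
  rw [hc, add_tsub_add_eq_tsub_left]

/-! ### Infinite paths of `Λ̃` -/

/-- Composition in `Λ̃` is defined by splicing chosen representatives; comparing the three
invariants of `tpath_ext` avoids unfolding the splice. -/
theorem tcomp_pmk_self (hΛ : Λ.LocallyConvex) (x : Λ.BoundaryPath) (p q t : Fin k → ℕ)
    (hpq : p ≤ q) (hqt : q ≤ t) :
    tcomp hΛ (pmk x p q hpq) (pmk x q t hqt) rfl = pmk x p t (hpq.trans hqt) := by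
  obtain ⟨h1, h2, h3⟩ := tcomp_spec hΛ (pmk x p q hpq) (pmk x q t hqt) rfl
  refine tpath_ext (h1.unique ?_) h2 ?_
  · exact x.isComp_seg _ _ _ (cap_mono hpq _) (cap_mono hqt _) (cap_le _ _)
  · rw [h3, add_comm]
    exact tsub_add_tsub_cancel hqt hpq

/-- The infinite path `(p, q) ↦ [x; (p, q)]` of `Λ̃`. -/
noncomputable def liftPath (hΛ : Λ.LocallyConvex) (x : Λ.BoundaryPath) :
    (Λ.removeSources hΛ).InfinitePath where
  obj p := vmk x p.1
  map f := pmk x f.1.1 f.1.2 f.2.1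
  r_map _ := rfl
  s_map _ := rfl
  map_id _ := rfl
  map_comp f g h := by
    have h' : f.1.2 = g.1.1 := Subtype.ext_iff.1 h
    obtain ⟨⟨p, q⟩, h1, h2⟩ := f
    obtain ⟨⟨q', t⟩, h3, h4⟩ := g
    replace h' : q = q' := h'
    subst h'
    exact (tcomp_pmk_self hΛ x p q t h1 h3).symm
  d_map _ := rfl

/-! ### Projecting an infinite path of `Λ̃` to a boundary path of `Λ`. -/

variable {hΛ : Λ.LocallyConvex} (z : (Λ.removeSources hΛ).InfinitePath)

/-- The path `z(p, q)` of `Λ̃`. -/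
def infSeg (p q : Fin k → ℕ) (h : p ≤ q) : Λ.TPath := z.map ⟨(p, q), h, fun _ => le_top⟩

theorem ts_infSeg (p q : Fin k → ℕ) (h : p ≤ q) :
    ts (infSeg z p q h) = z.obj ⟨q, fun _ => le_top⟩ := z.s_map _

theorem td_infSeg (p q : Fin k → ℕ) (h : p ≤ q) : td (infSeg z p q h) = q - p := z.d_map _

theorem ts_infSeg_eq_tr (p q t : Fin k → ℕ) (h : p ≤ q) (h' : q ≤ t) :
    ts (infSeg z p q h) = tr (infSeg z q t h') :=
  (z.s_map _).trans (z.r_map ⟨(q, t), h', fun _ => le_top⟩).symm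

theorem infSeg_spec (p q t : Fin k → ℕ) (h : p ≤ q) (h' : q ≤ t) :
    Λ.IsComp (tproj (infSeg z p q h)) (tproj (infSeg z q t h'))
      (tproj (infSeg z p t (h.trans h'))) ∧
    texc (infSeg z p t (h.trans h')) = texc (infSeg z p q h) := by
  obtain ⟨h1, h2, -⟩ := tcomp_spec hΛ (infSeg z p q h) (infSeg z q t h')
    (ts_infSeg_eq_tr z p q t h h')
  have e : infSeg z p t (h.trans h') = tcomp hΛ (infSeg z p q h) (infSeg z q t h')
      (ts_infSeg_eq_tr z p q t h h') :=
    z.map_comp ⟨(p, q), h, fun _ => le_top⟩ ⟨(q, t), h', fun _ => le_top⟩ rfl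
  rw [e]
  exact ⟨h1, h2⟩

/-- Excess accumulates along `z`: any degree lost under projection becomes excess at the source. -/
theorem texc_infSeg (p q t : Fin k → ℕ) (h : p ≤ q) (h' : q ≤ t) :
    texc (infSeg z q t h') =
      texc (infSeg z p q h) + (q - p) - Λ.d (tproj (infSeg z p q h)) := by
  rw [← td_infSeg z p q h]
  exact (ts_eq_tr_iff.1 (ts_infSeg_eq_tr z p q t h h')).2.symm

/-- If the path moves in direction `i` but its projection does not, the representing boundary path
is already exhausted in that direction at the range. -/
theorem not_receives_of_d_tproj_eq_zero (g : Λ.TPath) (i : Fin k) (h : td g i ≠ 0)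
    (h' : Λ.d (tproj g) i = 0) : ¬ Λ.Receives (Λ.r (tproj g)) (Pi.single i 1) := by
  obtain ⟨x, m, n, hmn, rfl⟩ := exists_pmk g
  change n i - m i ≠ 0 at h
  change Λ.d (x.capSeg m n hmn) i = 0 at h'
  change ¬ Λ.Receives (Λ.r (x.capSeg m n hmn)) _
  rw [x.r_capSeg]
  rw [BoundaryPath.capSeg, x.d_seg, Pi.sub_apply] at h'
  refine x.boundary _ (cap_le _ _) i ?_
  rcases cap_cases x.deg i with ⟨h1, h2⟩ | ⟨a, h1, h2⟩
  · rw [h2, h2] at h'; omega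
  · rw [h2, h2] at h'
    rw [h1, h2]
    have : min (m i) a = a := by omega
    rw [this]

/-- The projections to `Λ` of the initial segments `z(0, (j, …, j))` of `z`. -/
noncomputable def projInit (j : ℕ) : Λ.Path := tproj (infSeg z 0 (fun _ => j) zero_le)

theorem isComp_projInit (n : Fin k → ℕ) (j : ℕ) (h : n ≤ fun _ => j) :
    Λ.IsComp (tproj (infSeg z 0 n zero_le)) (tproj (infSeg z n (fun _ => j) h)) (projInit z j) :=
  (infSeg_spec z 0 n _ zero_le h).1

theorem isChainOfPaths_projInit : IsChainOfPaths (projInit z) := fun j =>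
  ⟨_, isComp_projInit z (fun _ => j) (j + 1) fun _ => Nat.le_succ j⟩

/-- The boundary path of `Λ` obtained by projecting the infinite path `z` of `Λ̃`. -/
noncomputable def projPath : Λ.BoundaryPath :=
  limit hΛ (isChainOfPaths_projInit z) fun i J hJ => by
    have h := isComp_projInit z (fun _ => J) (J + 1) fun _ => Nat.le_succ J
    refine ⟨J, le_rfl, ?_⟩
    have h1 := congrFun h.d_eq i
    rw [hJ _ (Nat.le_succ J)] at h1
    -- The segment of `z` from `(J, …, J)` to `(J + 1, …, J + 1)` has degree `1` at `i`, yet its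
    -- projection has degree `0` there.
    have h2 := not_receives_of_d_tproj_eq_zero _ i (by rw [td_infSeg]; simp) (add_eq_left.1 h1.symm)
    rwa [← h.1] at h2

/-- In each direction, either no degree has been lost up to `n`, or some has; in the latter case the
excess is positive from then on and the projection never grows again in that direction. -/
theorem cap_projPath (n : Fin k → ℕ) :
    cap n (projPath z).deg = Λ.d (tproj (infSeg z 0 n zero_le)) := by
  have hf := isChainOfPaths_projInit z
  funext i
  obtain ⟨J, hJ⟩ : ∃ J : ℕ, n ≤ fun _ => J :=
    ⟨Finset.univ.sup n, fun i => Finset.le_sup (Finset.mem_univ i)⟩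
  have hn : Λ.d (tproj (infSeg z 0 n zero_le)) i ≤ n i := by
    have := d_tproj_le (infSeg z 0 n zero_le) i
    rwa [td_infSeg, tsub_zero] at this
  have hle : ∀ j (hj : J ≤ j), Λ.d (projInit z j) i = Λ.d (tproj (infSeg z 0 n zero_le)) i +
      Λ.d (tproj (infSeg z n (fun _ => j) (hJ.trans fun _ => hj))) i :=
    fun j hj => congrFun (isComp_projInit z n j (hJ.trans fun _ => hj)).d_eq i
  have hD : (Λ.d (projInit z J) i : ℕ∞) ≤ (projPath z).deg i := d_le_limitDeg _ J i
  rcases hn.eq_or_lt with h | h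
  · have h1 : (n i : ℕ∞) ≤ (projPath z).deg i := by
      refine le_trans ?_ hD
      rw [hle J le_rfl, h]
      exact_mod_cast Nat.le_add_right _ _
    rw [h, cap, min_eq_left h1, ENat.toNat_natCast]
  · have hc : ∀ j, J ≤ j → Λ.d (projInit z j) i = Λ.d (tproj (infSeg z 0 n zero_le)) i :=
      fun j hj => by
        rw [hle j hj, add_eq_left]
        refine d_tproj_eq_zero _ i ?_
        rw [texc_infSeg z 0 n _ zero_le]
        simp only [Pi.add_apply, Pi.sub_apply, Pi.zero_apply]
        omega
    rw [hc J le_rfl] at hD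
    have hDi : (projPath z).deg i = (Λ.d (tproj (infSeg z 0 n zero_le)) i : ℕ) := by
      refine le_antisymm (iSup_le fun j => ?_) hD
      rw [← hc (max J j) (le_max_left _ _)]
      exact_mod_cast hf.d_mono (le_max_right J j) i
    rw [cap_of_coe hDi]
    omega

/-- By `cap_projPath`, the projection of `z(0, n)` is the initial segment of `projPath z` ending at
`n ∧ d`. -/
theorem capVert_projPath (n : Fin k → ℕ) :
    (projPath z).capVert n = Λ.s (tproj (infSeg z 0 n zero_le)) := by
  have hf := isChainOfPaths_projInit z
  obtain ⟨J, hJ⟩ : ∃ J : ℕ, n ≤ fun _ => J :=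
    ⟨Finset.univ.sup n, fun i => Finset.le_sup (Finset.mem_univ i)⟩
  have hc := isComp_projInit z n J hJ
  have h1 := (isSeg_self (tproj (infSeg z 0 n zero_le))).of_left hc
  rw [← cap_projPath] at h1
  have h2 := isSeg_limitSeg hf 0 (cap n (projPath z).deg) zero_le (cap_le _ _) (j := J) (by
    rw [cap_projPath, hc.d_eq]; exact le_self_add)
  rw [h1.unique h2]
  exact ((projPath z).s_seg 0 (cap n (projPath z).deg) zero_le (cap_le _ _)).symm

/-- An infinite path `z` of `Λ̃` has vertices `z(n) = [x; t + n]` for a boundary path `x` of `Λ`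
and some `t ∈ ℕ^k`. -/
theorem exists_obj_eq_vmk : ∃ (x : Λ.BoundaryPath) (t : Fin k → ℕ), ∀ n : Fin k → ℕ,
    z.obj ⟨n, fun _ => le_top⟩ = vmk x (t + n) := by
  refine ⟨projPath z, texc (infSeg z 0 0 zero_le), fun n => ?_⟩
  set t := texc (infSeg z 0 0 zero_le) with ht
  have htn : ∀ n, texc (infSeg z 0 n zero_le) = t := fun n =>
    (infSeg_spec z 0 0 n zero_le zero_le).2
  -- Where `t` is non-zero, `z` has excess from the start, so its projections have degree zero there
  -- and both sides vanish.
  have hcap : cap (t + n) (projPath z).deg = cap n (projPath z).deg := by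
    funext i
    by_cases hi : t i = 0
    · rcases cap_cases (projPath z).deg i with ⟨-, h⟩ | ⟨a, -, h⟩ <;> simp [h, hi]
    · rw [cap_projPath, cap_projPath, d_tproj_eq_zero _ i (by rwa [htn]),
        d_tproj_eq_zero _ i (by rwa [htn])]
  rw [← ts_infSeg z 0 n zero_le]
  have e1 := td_infSeg z 0 n zero_le
  have e2 := htn n
  have e3 := capVert_projPath z n
  have e4 := cap_projPath z n
  obtain ⟨y, p, q, hpq, hy⟩ := exists_pmk (infSeg z 0 n zero_le)
  rw [hy] at e1 e2 e3 e4 ⊢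
  refine vmk_eq_iff.2 ⟨?_, ?_⟩
  · rw [← y.s_capSeg p q hpq]
    refine e3.symm.trans ?_
    exact (projPath z).vert_congr hcap.symm _ _
  · rw [sub_cap_source y p q hpq, hcap, e1, e2, e4, tsub_zero]

end RemoveSources

/-! ### Cofinality -/

/-- For a `k`-graph without sources the two cofinality conditions agree. -/
theorem isCofinal_iff_isInfinitePathCofinal (Γ : KGraph.{u} k)
    (hΓ : ∀ (a : Γ.Vert) (i : Fin k), Γ.Receives a (Pi.single i 1)) :
    Γ.IsCofinal ↔ Γ.IsInfinitePathCofinal := by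
  constructor
  · intro h z a
    obtain ⟨n, _, f, hf⟩ := h ⟨fun _ => ⊤, z, fun p _ i hi => absurd hi (ENat.natCast_ne_top _)⟩ a
    exact ⟨n, f, hf⟩
  · rintro h ⟨deg, z, hb⟩ a
    have hdeg : deg = fun _ => ⊤ := by
      funext i
      by_contra hi
      obtain ⟨N, hN⟩ := ENat.ne_top_iff_exists.1 hi
      -- If `deg i` were a finite `N`, the point `N e_i` would lie on the boundary in direction `i`,
      -- but every vertex receives an edge.
      have hp : Le (Pi.single i N : Fin k → ℕ) deg := fun j => by
        by_cases hj : j = i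
        · subst hj; simp [hN]
        · simp [hj]
      exact hb _ hp i (by simp [hN]) (hΓ _ i)
    subst hdeg
    obtain ⟨n, f, hf⟩ := h z a
    exact ⟨n, fun _ => le_top, f, hf⟩

theorem removeSources_receives (hΛ : Λ.LocallyConvex) (a : (Λ.removeSources hΛ).Vert)
    (n : Fin k → ℕ) : (Λ.removeSources hΛ).Receives a n := by
  induction a using Quotient.inductionOn with
  | h v => exact ⟨pmk v.x v.m (v.m + n) le_self_add, rfl, add_tsub_cancel_left _ _⟩

/-- Cofinality of `Λ` is applied to the projected path and the vertex underlying `[y; m]`; the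
excess of `[y; m]` is restored on a boundary path through both. -/
theorem IsCofinal.removeSources (hΛ : Λ.LocallyConvex) (h : Λ.IsCofinal) :
    (Λ.removeSources hΛ).IsInfinitePathCofinal := by
  intro z a
  obtain ⟨x, t, hz⟩ := exists_obj_eq_vmk z
  induction a using Quotient.inductionOn with
  | h v =>
    obtain ⟨y, m⟩ := v
    obtain ⟨n, hn, f, hr, hs⟩ := h x (y.capVert m)
    have hs' : Λ.s f = (x.shift n hn).vert 0 (Le.zero _) :=
      hs.trans (x.vert_congr (zero_add n).symm _ _)
    set w := BoundaryPath.concat hΛ f (x.shift n hn) hs'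
    set e := m - cap m y.deg
    have hw0 : w.vert 0 (Le.zero _) = y.capVert m := by
      rw [← hr]
      have := BoundaryPath.isComp_concatSeg f (x.shift n hn) hs' 0 0 (Λ.d f) le_rfl zero_le
        (fun i => le_self_add)
      have hl := BoundaryPath.concatSeg_left f (x.shift n hn) hs' 0 (Λ.d f) zero_le
        (fun i => le_self_add) (isSeg_self f)
      exact this.r_eq.symm.trans (congrArg Λ.r hl)
    -- Going on to `z(n + e)` instead of `z(n)` makes room for the initial excess `e`. The source is
    -- `[w; d(f) + t + e] = [σⁿ(x); t + e] = [x; t + (n + e)]`.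
    refine ⟨n + e, pmk w e (Λ.d f + (t + e)) (le_add_self.trans le_add_self), ?_, ?_⟩
    · exact (vmk_eq_vmk_of_vert_zero y w m hw0).symm
    · rw [hz]
      refine (vmk_concat hΛ f (x.shift n hn) hs' (t + e)).trans ?_
      rw [vmk_shift, add_left_comm]

/-- A path of `Λ̃` from `[y; 0]` to `[x; n]` projects to a path of `Λ` from `y(0)` to `x(n ∧ d(x))`.
-/
theorem IsCofinal.of_removeSources (hΛ : Λ.LocallyConvex)
    (h : (Λ.removeSources hΛ).IsInfinitePathCofinal) : Λ.IsCofinal := by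
  intro x a
  obtain ⟨y, hy⟩ := exists_boundaryPath hΛ a
  obtain ⟨n, g, hr, hs⟩ := h (liftPath hΛ x) (vmk y 0)
  obtain ⟨w, p, q, hpq, rfl⟩ := exists_pmk g
  refine ⟨cap n x.deg, cap_le _ _, w.capSeg p q hpq, ?_, ?_⟩
  · rw [w.r_capSeg, (vmk_eq_iff.1 hr).1, ← hy]
    refine y.vert_congr ?_ _ _
    funext i
    rcases cap_cases y.deg i with ⟨-, h⟩ | ⟨b, -, h⟩ <;> simp [h]
  · rw [w.s_capSeg]
    exact (vmk_eq_iff.1 hs).1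

end KGraph

theorem mainTheorem5 {k : ℕ} (Λ : KGraph.{u} k) (hrf : Λ.RowFinite) (hlc : Λ.LocallyConvex) :
    (Λ.IsCofinal ↔ (Λ.removeSources hlc).IsCofinal) ∧
      (Λ.IsCofinal ↔ (Λ.removeSources hlc).IsInfinitePathCofinal) := by
  have h : Λ.IsCofinal ↔ (Λ.removeSources hlc).IsInfinitePathCofinal :=
    ⟨fun h => h.removeSources hlc, fun h => KGraph.IsCofinal.of_removeSources hlc h⟩
  exact ⟨h.trans (KGraph.isCofinal_iff_isInfinitePathCofinal _
    fun a _ => KGraph.removeSources_receives hlc a _).symm, h⟩
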